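/- Let $k$ be an arbitrary field, $m\ge 0$, and let $\mathcal A$ be a finite set of nonzero vectors in $\mathbb N^m$. For a finite set $\mathcal B=\{b_1,\dots,b_r\}\subset\mathbb N^m$ of distinct vectors, the toric ideal $I_{\mathcal B}$ is the kernel of the $k$-algebra homomorphism $k[x_1,\dots,x_r]\to k[t_1,\dots,t_m]$, $x_i\mapsto t^{b_i}$. It is called a complete intersection if $\mu(I_{\mathcal B})=\mathrm{ht}(I_{\mathcal B})$, where $\mu$ denotes the minimal number of generators and $\mathrm{ht}$ the height. For $\mathcal S\subset\mathbb N^m$, let $\mathbb N\mathcal S$, $\mathbb Z\mathcal S$ and $\mathbb Q\mathcal S$ denote the sets of its finite linear combinations with coefficients in $\mathbb N$, $\mathbb Z$ and $\mathbb Q$ respectively. An elementary reduction step applied to a finite set $\mathcal B\subset\mathbb N^m$ consists of choosing some $a\in\mathcal B$, putting $\mathcal S=\mathcal B\setminus\{a\}$, and proceeding as follows. - If $a\notin\mathbb Q\mathcal S$, replace $\mathcal B$ by $\mathcal S$. - If $a\in\mathbb Q\mathcal S$, let $B=\min\{b\in\mathbb Z^+ \mid b\,a\in\mathbb Z\mathcal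 S\}$. Replace $\mathcal B$ by $\mathcal S$ if $B a\in\mathbb N\mathcal S$, and by $\mathcal S\cup\{B a\}$ if $B a\notin\mathbb N\mathcal S$. A finite set $\mathcal R\subset\mathbb N^m$ is fully reduced if $a\in\mathbb Z(\mathcal R\setminus\{a\})\setminus\mathbb N(\mathcal R\setminus\{a\})$ for every $a\in\mathcal R$; in particular, $\emptyset$ is fully reduced. **Theorem.** There is exactly one fully reduced set, denoted $\mathcal A_{red}$, that can be obtained from $\mathcal A$ by finitely many elementary reduction steps, performed in any order. Moreover, $I_{\mathcal A}$ is a complete intersection if and only if either $\mathcal A_{red}=\emptyset$ or $I_{\mathcal A_{red}}$ is a complete intersection. -/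

import Mathlib

namespace ToricReduction

/-- The toric ideal of a finite set `A ⊆ ℕ^m` over `k`: the kernel of the `k`-algebra homomorphism
`k[x_a : a ∈ A] → k[t_1, …, t_m]`, `x_a ↦ t^a = t_1^{a_1} ⋯ t_m^{a_m}`. -/
noncomputable def toricIdeal (k : Type*) [Field k] {m : ℕ} (A : Finset (Fin m → ℕ)) :
    Ideal (MvPolynomial {a : Fin m → ℕ // a ∈ A} k) :=
  RingHom.ker (MvPolynomial.aeval (R := k)
    (fun a : {a : Fin m → ℕ // a ∈ A} =>
      ∏ j : Fin m, (MvPolynomial.X j : MvPolynomial (Fin m) k) ^ (a.1 j)))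

/-- `I` is a complete intersection: `μ(I) = ht(I)`, the minimal number of generators equals the
height. (Used only in Noetherian rings, where every ideal is finitely generated and
`Submodule.spanFinrank` is the minimal number of generators.) -/
def IsCompleteIntersection {R : Type*} [CommRing R] (I : Ideal R) : Prop :=
  (Submodule.spanFinrank I : ℕ∞) = I.height

/-- The additive monoid `ℕ S` of non-negative integer combinations of `S`. -/
def natSpan {m : ℕ} (S : Finset (Fin m → ℕ)) : AddSubmonoid (Fin m → ℕ) :=
  AddSubmonoid.closure (S : Set (Fin m → ℕ))

/-- The group `ℤ S ⊆ ℤ^m` of integer combinations of `S`. -/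
def intSpan {m : ℕ} (S : Finset (Fin m → ℕ)) : AddSubgroup (Fin m → ℤ) :=
  AddSubgroup.closure ((fun (a : Fin m → ℕ) (j : Fin m) => (a j : ℤ)) '' (S : Set (Fin m → ℕ)))

/-- The subspace `ℚ S ⊆ ℚ^m` of rational combinations of `S`. -/
def ratSpan {m : ℕ} (S : Finset (Fin m → ℕ)) : Submodule ℚ (Fin m → ℚ) :=
  Submodule.span ℚ ((fun (a : Fin m → ℕ) (j : Fin m) => (a j : ℚ)) '' (S : Set (Fin m → ℕ)))

/-- `B` is the smallest positive integer `b` with `b a ∈ ℤ S`. -/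
def IsMinMultiplier {m : ℕ} (S : Finset (Fin m → ℕ)) (a : Fin m → ℕ) (B : ℕ) : Prop :=
  IsLeast {b : ℕ | 0 < b ∧ (fun j : Fin m => (b : ℤ) * (a j : ℤ)) ∈ intSpan S} B

/-- One elementary step of the reduction: pick any `a ∈ A`, and let `S = A \ {a}`.
If `a ∉ ℚ S`, drop `a`. Otherwise, with `B` the least positive integer such that `B a ∈ ℤ S`,
drop `a` when `B a ∈ ℕ S`, and replace `a` by `B a` when `B a ∉ ℕ S`. -/
inductive Step {m : ℕ} : Finset (Fin m → ℕ) → Finset (Fin m → ℕ) → Prop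
  | independent (A : Finset (Fin m → ℕ)) (a : Fin m → ℕ) (ha : a ∈ A)
      (hQ : (fun j : Fin m => (a j : ℚ)) ∉ ratSpan (A.erase a)) :
      Step A (A.erase a)
  | redundant (A : Finset (Fin m → ℕ)) (a : Fin m → ℕ) (ha : a ∈ A)
      (hQ : (fun j : Fin m => (a j : ℚ)) ∈ ratSpan (A.erase a))
      (B : ℕ) (hB : IsMinMultiplier (A.erase a) a B)
      (hN : B • a ∈ natSpan (A.erase a)) :
      Step A (A.erase a)
  | scale (A : Finset (Fin m → ℕ)) (a : Fin m → ℕ) (ha : a ∈ A)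
      (hQ : (fun j : Fin m => (a j : ℚ)) ∈ ratSpan (A.erase a))
      (B : ℕ) (hB : IsMinMultiplier (A.erase a) a B)
      (hN : B • a ∉ natSpan (A.erase a)) :
      Step A (insert (B • a) (A.erase a))

/-- `R` is fully reduced: each `a ∈ R` lies in `ℤ (R \ {a})` but not in `ℕ (R \ {a})`
(the empty set is fully reduced). Equivalently, no elementary step changes `R`. -/
def IsFullyReduced {m : ℕ} (R : Finset (Fin m → ℕ)) : Prop :=
  ∀ a ∈ R, (fun j : Fin m => (a j : ℤ)) ∈ intSpan (R.erase a) ∧ a ∉ natSpan (R.erase a)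

/-- `R` is an outcome `A_red` of the reduction of `A`: a fully reduced set obtained from `A` by
finitely many elementary steps, performed in any order. -/
def IsReductionOf {m : ℕ} (A R : Finset (Fin m → ℕ)) : Prop :=
  Relation.ReflTransGen Step A R ∧ IsFullyReduced R

end ToricReduction

/-! Let `B` be the order of `a` modulo `ℤS`, with `B = 0` if it is infinite. A step at `a` replaces
`S ∪ {a}` by `S` or by `S ∪ {Ba}`. Uniqueness is Newman's lemma. A step that changes the set either
lowers its cardinality or replaces a vector of order `B > 1` by one of order 1, without altering the
orders of the others, so such steps terminate (`complexity_lt`). They are locally confluent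
(`step_locally_confluent`): the coefficient of `b` in any relation over `S ∪ {a, b}` is divisible by
the order of `b` modulo `ℤ(S ∪ {a})`, so rescaling `b` changes neither the order of `a` nor whether
the corresponding multiple of `a` is redundant.

For complete intersections, view the ideal `P` of `S ∪ {a}` in `k[x_s][X]`, where it contracts to
the ideal `I` of `S`. In every binomial of `P` the two exponents of `X` are congruent modulo `B`. If
`B = 0`, then `P` is the extension of `I`, with the same height and number of generators. If `B ≠
0`, then `ht P = ht I + 1`. If moreover `Ba = deg n` lies in `ℕS`, then `P` is generated by `I` and
`X^B - x^n`, and `μ(P) = μ(I) + 1` (`spanFinrank_stepIdeal_of_mem`). Otherwise `P` is extended from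
the ideal of `S ∪ {Ba}` along `X ↦ X^B`, and `μ` is unchanged (`spanFinrank_stepIdeal_nsmul`). So `μ
- ht` is preserved. The lower bounds for `μ(P)` use minimal generating sets of binomials, which
graded Nakayama provides because the vectors are nonzero (`exists_binomial_generators`). -/

namespace ToricReduction

/-! ### Orders modulo `ℤS` and elementary steps. -/

variable {m : ℕ}

/-- The inclusion `ℕ^m → ℤ^m`. -/
def toInt : (Fin m → ℕ) →+ (Fin m → ℤ) where
  toFun a j := (a j : ℤ)
  map_zero' := by ext; simp
  map_add' a b := by ext; simp

/-- The order of `a` modulo `ℤ S`: the least positive `b` with `b a ∈ ℤ S`, and `0` if there is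
none. -/
noncomputable def mult (S : Finset (Fin m → ℕ)) (a : Fin m → ℕ) : ℕ :=
  addOrderOf (QuotientAddGroup.mk (toInt a) : (Fin m → ℤ) ⧸ intSpan S)

theorem toInt_mul (b : ℕ) (a : Fin m → ℕ) :
    (fun j => (b : ℤ) * (a j : ℤ)) = (b : ℤ) • toInt a := by
  ext j; simp [toInt]

theorem toInt_nsmul (b : ℕ) (a : Fin m → ℕ) : toInt (b • a) = (b : ℤ) • toInt a := by
  rw [map_nsmul, natCast_zsmul]

theorem mult_dvd_iff {S : Finset (Fin m → ℕ)} {a : Fin m → ℕ} {z : ℤ} :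
    (mult S a : ℤ) ∣ z ↔ z • toInt a ∈ intSpan S := by
  rw [mult, addOrderOf_dvd_iff_zsmul_eq_zero, ← QuotientAddGroup.mk_zsmul,
    QuotientAddGroup.eq_zero_iff]

theorem mult_eq_of_forall {S T : Finset (Fin m → ℕ)} {a b : Fin m → ℕ}
    (h : ∀ z : ℤ, z • toInt a ∈ intSpan S ↔ z • toInt b ∈ intSpan T) : mult S a = mult T b := by
  refine Nat.dvd_antisymm ?_ ?_ <;> rw [← Int.natCast_dvd_natCast, mult_dvd_iff]
  · rw [h, ← mult_dvd_iff]
  · rw [← h, ← mult_dvd_iff]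

theorem isMinMultiplier_iff {S : Finset (Fin m → ℕ)} {a : Fin m → ℕ} {B : ℕ} :
    IsMinMultiplier S a B ↔ 0 < B ∧ B = mult S a := by
  have key : ∀ b : ℕ, (fun j : Fin m => (b : ℤ) * (a j : ℤ)) ∈ intSpan S ↔ mult S a ∣ b := by
    intro b
    rw [toInt_mul, ← mult_dvd_iff, Int.natCast_dvd_natCast]
  constructor
  · rintro ⟨⟨h0, h1⟩, h2⟩
    rw [key] at h1
    have hm : 0 < mult S a := Nat.pos_of_dvd_of_pos h1 h0
    exact ⟨h0, le_antisymm (h2 ⟨hm, (key _).2 dvd_rfl⟩) (Nat.le_of_dvd h0 h1)⟩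
  · rintro ⟨h0, rfl⟩
    exact ⟨⟨h0, (key _).2 dvd_rfl⟩, fun b ⟨hb0, hb⟩ => Nat.le_of_dvd hb0 ((key b).1 hb)⟩

/-- The inclusion `ℤ^m → ℚ^m`. -/
def intToRat : (Fin m → ℤ) →+ (Fin m → ℚ) where
  toFun a j := (a j : ℚ)
  map_zero' := by ext; simp
  map_add' a b := by ext; simp

theorem intToRat_mem_ratSpan {S : Finset (Fin m → ℕ)} {y : Fin m → ℤ} (hy : y ∈ intSpan S) :
    intToRat y ∈ ratSpan S := by
  induction hy using AddSubgroup.closure_induction with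
  | mem x hx =>
    obtain ⟨a, ha, rfl⟩ := hx
    exact Submodule.subset_span ⟨a, ha, by ext; simp [intToRat]⟩
  | zero => simp
  | add x y _ _ hx hy => simpa using add_mem hx hy
  | neg x _ hx => simpa using hx

theorem exists_multiple_of_mem_ratSpan {S : Finset (Fin m → ℕ)} {x : Fin m → ℚ}
    (hx : x ∈ ratSpan S) : ∃ n : ℕ, 0 < n ∧ ∃ y ∈ intSpan S, (n : ℚ) • x = intToRat y := by
  induction hx using Submodule.span_induction with
  | mem x hx =>
    obtain ⟨a, ha, rfl⟩ := hx
    exact ⟨1, one_pos, toInt a, AddSubgroup.subset_closure ⟨a, ha, rfl⟩, by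
      ext; simp [intToRat, toInt]⟩
  | zero => exact ⟨1, one_pos, 0, zero_mem _, by simp⟩
  | add x y _ _ hx hy =>
    obtain ⟨n, hn, u, hu, e⟩ := hx
    obtain ⟨n', hn', u', hu', e'⟩ := hy
    refine ⟨n * n', Nat.mul_pos hn hn', n' • u + n • u',
      add_mem (nsmul_mem hu _) (nsmul_mem hu' _), ?_⟩
    rw [map_add, map_nsmul, map_nsmul, ← e, ← e']
    ext j
    simp
    ring
  | smul q x _ hx =>
    obtain ⟨n, hn, u, hu, e⟩ := hx
    refine ⟨n * q.den, Nat.mul_pos hn q.den_pos, q.num • u, zsmul_mem hu _, ?_⟩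
    rw [map_zsmul, ← e]
    ext j
    simp only [Pi.smul_apply, smul_eq_mul, zsmul_eq_mul, Nat.cast_mul]
    have := Rat.den_mul_eq_num q
    rw [← this]
    ring

theorem mem_ratSpan_iff {S : Finset (Fin m → ℕ)} {a : Fin m → ℕ} :
    (fun j : Fin m => (a j : ℚ)) ∈ ratSpan S ↔ mult S a ≠ 0 := by
  have hcast : (fun j : Fin m => (a j : ℚ)) = intToRat (toInt a) := by
    ext; simp [intToRat, toInt]
  rw [hcast]
  constructor
  · intro h h0
    obtain ⟨n, hn, y, hy, e⟩ := exists_multiple_of_mem_ratSpan h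
    have : (n : ℤ) • toInt a ∈ intSpan S := by
      convert hy
      ext j
      have := congrFun e j
      simp only [intToRat, AddMonoidHom.coe_mk, ZeroHom.coe_mk, Pi.smul_apply, smul_eq_mul] at this
      simp only [Pi.smul_apply, smul_eq_mul]
      exact_mod_cast this
    rw [← mult_dvd_iff, Int.natCast_dvd_natCast, h0] at this
    exact hn.ne' (Nat.eq_zero_of_zero_dvd this)
  · intro h0
    have h : (mult S a : ℤ) • toInt a ∈ intSpan S := mult_dvd_iff.1 dvd_rfl
    have := intToRat_mem_ratSpan h
    rw [map_zsmul] at this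
    have h2 := (ratSpan S).smul_mem ((mult S a : ℚ)⁻¹) this
    rw [← Int.cast_smul_eq_zsmul ℚ, smul_smul] at h2
    simpa [h0] using h2

open Classical in
/-- The outcome of an elementary reduction step at `a`, where `S` is the set of the other
vectors. -/
noncomputable def reduceAt (S : Finset (Fin m → ℕ)) (a : Fin m → ℕ) : Finset (Fin m → ℕ) :=
  if mult S a • a ∈ natSpan S then S else insert (mult S a • a) S

theorem reduceAt_of_mem {S : Finset (Fin m → ℕ)} {a : Fin m → ℕ}
    (h : mult S a • a ∈ natSpan S) : reduceAt S a = S := by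
  rw [reduceAt, if_pos h]

theorem reduceAt_of_notMem {S : Finset (Fin m → ℕ)} {a : Fin m → ℕ}
    (h : mult S a • a ∉ natSpan S) : reduceAt S a = insert (mult S a • a) S := by
  rw [reduceAt, if_neg h]

/-- The independent case is order `0`: then `0 • a = 0` lies in `ℕS`, so it merges with the
redundant case. -/
theorem step_iff {A A' : Finset (Fin m → ℕ)} :
    Step A A' ↔ ∃ a ∈ A, A' = reduceAt (A.erase a) a := by
  constructor
  · intro h
    obtain ⟨a, ha, hQ⟩ | ⟨a, ha, hQ, B, hB, hN⟩ | ⟨a, ha, hQ, B, hB, hN⟩ := h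
    · rw [mem_ratSpan_iff, not_not] at hQ
      exact ⟨a, ha, (reduceAt_of_mem (by simp [hQ])).symm⟩
    · obtain ⟨-, rfl⟩ := isMinMultiplier_iff.1 hB
      exact ⟨a, ha, (reduceAt_of_mem hN).symm⟩
    · obtain ⟨-, rfl⟩ := isMinMultiplier_iff.1 hB
      exact ⟨a, ha, (reduceAt_of_notMem hN).symm⟩
  · rintro ⟨a, ha, rfl⟩
    by_cases h0 : mult (A.erase a) a = 0
    · rw [reduceAt_of_mem (by simp [h0])]
      exact Step.independent A a ha (by rw [mem_ratSpan_iff, not_not]; exact h0)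
    · have hB : IsMinMultiplier (A.erase a) a (mult (A.erase a) a) :=
        isMinMultiplier_iff.2 ⟨Nat.pos_of_ne_zero h0, rfl⟩
      by_cases hN : mult (A.erase a) a • a ∈ natSpan (A.erase a)
      · rw [reduceAt_of_mem hN]
        exact Step.redundant A a ha (mem_ratSpan_iff.2 h0) _ hB hN
      · rw [reduceAt_of_notMem hN]
        exact Step.scale A a ha (mem_ratSpan_iff.2 h0) _ hB hN

theorem step_insert {S : Finset (Fin m → ℕ)} {a : Fin m → ℕ} (ha : a ∉ S) :
    Step (insert a S) (reduceAt S a) :=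
  step_iff.2 ⟨a, Finset.mem_insert_self _ _, by rw [Finset.erase_insert ha]⟩

theorem isFullyReduced_iff {R : Finset (Fin m → ℕ)} :
    IsFullyReduced R ↔ ∀ a ∈ R, mult (R.erase a) a = 1 ∧ a ∉ natSpan (R.erase a) := by
  refine forall₂_congr fun a _ => and_congr_left' ?_
  have := mult_dvd_iff (S := R.erase a) (a := a) (z := 1)
  rw [one_smul] at this
  refine this.symm.trans ?_
  rw [← Nat.cast_one, Int.natCast_dvd_natCast, Nat.dvd_one]

theorem mem_natSpan_insert {S : Finset (Fin m → ℕ)} {a x : Fin m → ℕ} :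
    x ∈ natSpan (insert a S) ↔ ∃ n : ℕ, ∃ s ∈ natSpan S, n • a + s = x := by
  rw [natSpan, Finset.coe_insert, Set.insert_eq, AddSubmonoid.closure_union, AddSubmonoid.mem_sup]
  simp [AddSubmonoid.mem_closure_singleton, natSpan]

theorem mem_intSpan_insert {S : Finset (Fin m → ℕ)} {a : Fin m → ℕ} {x : Fin m → ℤ} :
    x ∈ intSpan (insert a S) ↔ ∃ n : ℤ, x + n • toInt a ∈ intSpan S := by
  rw [intSpan, Finset.coe_insert, Set.image_insert_eq, Set.insert_eq, AddSubgroup.closure_union,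
    AddSubgroup.mem_sup]
  constructor
  · rintro ⟨y, hy, z, hz, rfl⟩
    obtain ⟨n, rfl⟩ := AddSubgroup.mem_closure_singleton.1 hy
    refine ⟨-n, ?_⟩
    have : n • toInt a + z + -n • toInt a = z := by rw [neg_smul]; abel
    rw [← this] at hz
    exact hz
  · rintro ⟨n, hn⟩
    refine ⟨-n • toInt a, AddSubgroup.mem_closure_singleton.2 ⟨-n, rfl⟩, _, hn, ?_⟩
    rw [neg_smul]; abel

theorem intSpan_mono {S T : Finset (Fin m → ℕ)} (h : S ⊆ T) : intSpan S ≤ intSpan T :=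
  AddSubgroup.closure_mono (Set.image_mono (by exact_mod_cast h))

theorem mem_natSpan_of_mem {S : Finset (Fin m → ℕ)} {a : Fin m → ℕ} (h : a ∈ S) :
    a ∈ natSpan S := AddSubmonoid.subset_closure h

theorem toInt_mem_intSpan {S : Finset (Fin m → ℕ)} {x : Fin m → ℕ} (hx : x ∈ natSpan S) :
    toInt x ∈ intSpan S := by
  induction hx using AddSubmonoid.closure_induction with
  | mem x hx => exact AddSubgroup.subset_closure ⟨x, hx, rfl⟩
  | zero => simp
  | add x y _ _ hx hy => simpa using add_mem hx hy

theorem mult_dvd_mult {S T : Finset (Fin m → ℕ)} (h : S ⊆ T) (a : Fin m → ℕ) :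
    mult T a ∣ mult S a := by
  rw [← Int.natCast_dvd_natCast, mult_dvd_iff]
  exact intSpan_mono h (mult_dvd_iff.1 dvd_rfl)

theorem mult_nsmul_mul {S : Finset (Fin m → ℕ)} {a : Fin m → ℕ} {c : ℕ} (h : c ∣ mult S a) :
    mult S (c • a) * c = mult S a := by
  obtain ⟨d, hd⟩ := h
  rcases Nat.eq_zero_or_pos c with rfl | hc
  · simp [hd]
  · rw [hd, mul_comm]
    congr 1
    refine Nat.dvd_antisymm ?_ ?_
    · rw [← Int.natCast_dvd_natCast, mult_dvd_iff, toInt_nsmul, smul_smul, ← mult_dvd_iff, hd]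
      simp [mul_comm]
    · have : (mult S (c • a) : ℤ) • toInt (c • a) ∈ intSpan S := mult_dvd_iff.1 dvd_rfl
      rw [toInt_nsmul, smul_smul, ← mult_dvd_iff, hd, ← Nat.cast_mul, Int.natCast_dvd_natCast,
        mul_comm c d] at this
      exact Nat.dvd_of_mul_dvd_mul_right hc this

/-- The order of `c a` is the order of `a` divided by `c`, so both steps reach the same multiple of
`a`. -/
theorem reduceAt_nsmul {S : Finset (Fin m → ℕ)} {a : Fin m → ℕ} {c : ℕ} (h : c ∣ mult S a) :
    reduceAt S (c • a) = reduceAt S a := by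
  rw [reduceAt, reduceAt, smul_smul, mult_nsmul_mul h]

/-! ### Local confluence. -/

section TwoElements

variable {S : Finset (Fin m → ℕ)} {a b : Fin m → ℕ}

/-- If `z a + n b ∈ ℤS`, then the order of `b` modulo `ℤ(S ∪ {a})` divides `n`; rescaling `b` by it
therefore loses no relation. -/
theorem mult_insert_nsmul_mult :
    mult (insert (mult (insert a S) b • b) S) a = mult (insert b S) a := by
  refine mult_eq_of_forall fun z => ?_
  rw [mem_intSpan_insert, mem_intSpan_insert]
  constructor
  · rintro ⟨n, hn⟩
    refine ⟨n * mult (insert a S) b, ?_⟩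
    rwa [toInt_nsmul, smul_smul] at hn
  · rintro ⟨n, hn⟩
    have : n • toInt b ∈ intSpan (insert a S) := mem_intSpan_insert.2 ⟨z, by rwa [add_comm]⟩
    obtain ⟨d, rfl⟩ := mult_dvd_iff.2 this
    refine ⟨d, ?_⟩
    rwa [toInt_nsmul, smul_smul, mul_comm d]

theorem nsmul_mult_mem_natSpan_iff :
    mult (insert b S) a • a ∈ natSpan (insert (mult (insert a S) b • b) S) ↔
      mult (insert b S) a • a ∈ natSpan (insert b S) := by
  rw [mem_natSpan_insert, mem_natSpan_insert]
  constructor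
  · rintro ⟨n, s, hs, e⟩
    exact ⟨n * mult (insert a S) b, s, hs, by rw [← e, smul_smul]⟩
  · rintro ⟨n, s, hs, e⟩
    have : (n : ℤ) • toInt b ∈ intSpan (insert a S) := by
      refine mem_intSpan_insert.2 ⟨-(mult (insert b S) a), ?_⟩
      rw [neg_smul, ← toInt_nsmul, ← toInt_nsmul, ← e, map_add]
      have := toInt_mem_intSpan hs
      simpa using this
    obtain ⟨d, rfl⟩ := Int.natCast_dvd_natCast.1 (mult_dvd_iff.2 this)
    exact ⟨d, s, hs, by rw [← e, smul_smul, mul_comm d]⟩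

/-- If both multiples are non-negative combinations of the remaining vectors, they coincide or
neither needs the other vector. -/
theorem eq_or_mem_natSpan_of_mem (ha : mult (insert b S) a • a ∈ natSpan (insert b S))
    (hb : mult (insert a S) b • b ∈ natSpan (insert a S)) :
    mult (insert b S) a • a = mult (insert a S) b • b ∨
      mult (insert b S) a • a ∈ natSpan S ∧ mult (insert a S) b • b ∈ natSpan S := by
  rw [← nsmul_mult_mem_natSpan_iff, mem_natSpan_insert] at ha hb
  set x := mult (insert b S) a • a
  set y := mult (insert a S) b • b
  obtain ⟨n, s, hs, ex⟩ := ha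
  obtain ⟨n', s', hs', ey⟩ := hb
  rcases Nat.eq_zero_or_pos n with rfl | hn
  · have hx : x ∈ natSpan S := by simpa [← ex] using hs
    exact Or.inr ⟨hx, by rw [← ey]; exact add_mem (nsmul_mem hx _) hs'⟩
  rcases Nat.eq_zero_or_pos n' with rfl | hn'
  · have hy : y ∈ natSpan S := by simpa [← ey] using hs'
    exact Or.inr ⟨by rw [← ex]; exact add_mem (nsmul_mem hy _) hs, hy⟩
  -- Here `n, n' ≥ 1`, so `x = n y + s` and `y = n' x + s'` force `y ≤ x ≤ y` in each coordinate.
  left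
  ext j
  have h1 : n * y j + s j = x j := by simpa using congrFun ex j
  have h2 : n' * x j + s' j = y j := by simpa using congrFun ey j
  have h3 : y j ≤ n * y j := Nat.le_mul_of_pos_left _ hn
  have h4 : x j ≤ n' * x j := Nat.le_mul_of_pos_left _ hn'
  omega

/-- Steps at two different vectors can be joined, when the first of them only rescales. -/
theorem join_of_notMem (ha : a ∉ S) (hb : b ∉ S)
    (hA : mult (insert b S) a • a ∉ natSpan (insert b S)) :
    ∃ D, Relation.ReflTransGen Step (reduceAt (insert b S) a) D ∧
      Relation.ReflTransGen Step (reduceAt (insert a S) b) D := by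
  have hA' : mult (insert b S) a • a ∉ natSpan (insert (mult (insert a S) b • b) S) := by
    rwa [nsmul_mult_mem_natSpan_iff]
  have hbx : b ∉ insert (mult (insert b S) a • a) S := by
    intro h
    rcases Finset.mem_insert.1 h with h | h
    · exact hA (by rw [← h]; exact mem_natSpan_of_mem (Finset.mem_insert_self _ _))
    · exact hb h
  have hxS : mult (insert b S) a • a ∉ S := fun h =>
    hA (mem_natSpan_of_mem (Finset.mem_insert_of_mem h))
  rw [reduceAt_of_notMem hA, Finset.insert_comm]
  have h1 := step_insert hbx
  by_cases hB : mult (insert a S) b • b ∈ natSpan (insert a S)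
  · have hB' := nsmul_mult_mem_natSpan_iff.2 hB
    rw [reduceAt_of_mem hB]
    rw [reduceAt_of_mem (by rwa [mult_insert_nsmul_mult])] at h1
    -- After `b` is dropped from both sides, `S` together with a multiple of `a` reduces as `S ∪
    -- {a}` does.
    refine ⟨reduceAt S a, ?_, .single (step_insert ha)⟩
    refine (Relation.ReflTransGen.single h1).tail ?_
    have := step_insert hxS
    rwa [reduceAt_nsmul (mult_dvd_mult (Finset.subset_insert _ _) _)] at this
  · have hB' : mult (insert a S) b • b ∉ natSpan (insert (mult (insert b S) a • a) S) := by
      rwa [nsmul_mult_mem_natSpan_iff]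
    rw [reduceAt_of_notMem hB]
    rw [reduceAt_of_notMem (by rwa [mult_insert_nsmul_mult]), mult_insert_nsmul_mult] at h1
    refine ⟨_, .single h1, ?_⟩
    have hax : a ∉ insert (mult (insert a S) b • b) S := by
      intro h
      rcases Finset.mem_insert.1 h with h | h
      · exact hB (by rw [← h]; exact mem_natSpan_of_mem (Finset.mem_insert_self _ _))
      · exact ha h
    have h2 := step_insert hax
    rw [reduceAt_of_notMem (by rwa [mult_insert_nsmul_mult]), mult_insert_nsmul_mult] at h2
    rw [Finset.insert_comm, Finset.insert_comm (mult (insert a S) b • b)]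
    exact .single h2

theorem join_insert_insert (ha : a ∉ S) (hb : b ∉ S) :
    ∃ D, Relation.ReflTransGen Step (reduceAt (insert b S) a) D ∧
      Relation.ReflTransGen Step (reduceAt (insert a S) b) D := by
  by_cases hA : mult (insert b S) a • a ∈ natSpan (insert b S)
  swap
  · exact join_of_notMem ha hb hA
  by_cases hB : mult (insert a S) b • b ∈ natSpan (insert a S)
  swap
  · obtain ⟨D, h1, h2⟩ := join_of_notMem hb ha hB
    exact ⟨D, h2, h1⟩
  rw [reduceAt_of_mem hA, reduceAt_of_mem hB]
  refine ⟨reduceAt S b, .single (step_insert hb), ?_⟩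
  have hda : mult (insert b S) a ∣ mult S a := mult_dvd_mult (Finset.subset_insert _ _) _
  have hdb : mult (insert a S) b ∣ mult S b := mult_dvd_mult (Finset.subset_insert _ _) _
  -- Both vectors are redundant. Either their multiples coincide, or both multiples lie in `ℕS` and
  -- both sides reduce to `S`.
  have : reduceAt S b = reduceAt S a := by
    rcases eq_or_mem_natSpan_of_mem hA hB with h | ⟨h1, h2⟩
    · rw [← reduceAt_nsmul hda, h, reduceAt_nsmul hdb]
    · rw [reduceAt_of_mem, reduceAt_of_mem]
      · rw [← mult_nsmul_mul hda, ← smul_smul]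
        exact nsmul_mem h1 _
      · rw [← mult_nsmul_mul hdb, ← smul_smul]
        exact nsmul_mem h2 _
  rw [this]
  exact .single (step_insert ha)

end TwoElements

theorem step_locally_confluent {A A₁ A₂ : Finset (Fin m → ℕ)} (h₁ : Step A A₁) (h₂ : Step A A₂) :
    ∃ D, Relation.ReflTransGen Step A₁ D ∧ Relation.ReflTransGen Step A₂ D := by
  obtain ⟨a, ha, rfl⟩ := step_iff.1 h₁
  obtain ⟨b, hb, rfl⟩ := step_iff.1 h₂
  by_cases hab : a = b
  · subst hab
    exact ⟨_, .refl, .refl⟩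
  have e1 : A.erase a = insert b ((A.erase a).erase b) :=
    (Finset.insert_erase (Finset.mem_erase.2 ⟨Ne.symm hab, hb⟩)).symm
  have e2 : A.erase b = insert a ((A.erase a).erase b) := by
    rw [Finset.erase_right_comm]
    exact (Finset.insert_erase (Finset.mem_erase.2 ⟨hab, ha⟩)).symm
  rw [e1, e2]
  exact join_insert_insert (by simp) (by simp)

/-! ### Termination and uniqueness of the reduction. -/

/-- The quantity that decreases, lexicographically, in every step that changes the set. -/
noncomputable def complexity (A : Finset (Fin m → ℕ)) : ℕ ×ₗ ℕ :=
  toLex (A.card, ∑ x ∈ A, mult (A.erase x) x)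

theorem complexity_lt {A A' : Finset (Fin m → ℕ)} (h : Step A A') (hne : A ≠ A') :
    complexity A' < complexity A := by
  obtain ⟨a, ha, rfl⟩ := step_iff.1 h
  obtain ⟨S, haS, rfl⟩ : ∃ S, a ∉ S ∧ A = insert a S :=
    ⟨A.erase a, by simp, (Finset.insert_erase ha).symm⟩
  rw [Finset.erase_insert haS] at *
  by_cases hN : mult S a • a ∈ natSpan S
  · rw [reduceAt_of_mem hN, complexity, complexity, Prod.Lex.toLex_lt_toLex]
    left
    simp [Finset.card_insert_of_notMem haS]
  · rw [reduceAt_of_notMem hN] at *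
    have hxS : mult S a • a ∉ S := fun h => hN (mem_natSpan_of_mem h)
    rw [complexity, complexity, Prod.Lex.toLex_lt_toLex]
    right
    refine ⟨by rw [Finset.card_insert_of_notMem haS, Finset.card_insert_of_notMem hxS], ?_⟩
    dsimp only
    rw [Finset.sum_insert haS, Finset.sum_insert hxS, Finset.erase_insert haS,
      Finset.erase_insert hxS]
    -- The term of `a` drops from its order, which is greater than 1, to 1; the other orders are
    -- kept by `mult_insert_nsmul_mult`.
    refine add_lt_add_of_lt_of_le ?_ (le_of_eq (Finset.sum_congr rfl fun x hx => ?_))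
    · have h0 : mult S a ≠ 0 := fun h0 => hN (by simp [h0])
      have h1 : mult S a ≠ 1 := fun h1 => hne (by simp [h1])
      have := mult_nsmul_mul (dvd_refl (mult S a))
      have : mult S (mult S a • a) = 1 :=
        Nat.eq_of_mul_eq_mul_right (Nat.pos_of_ne_zero h0) (by rw [this, one_mul])
      omega
    · have hxa : x ≠ a := by rintro rfl; exact haS hx
      have hxy : x ≠ mult S a • a := by rintro h; exact hxS (h ▸ hx)
      rw [Finset.erase_insert_of_ne hxa.symm, Finset.erase_insert_of_ne hxy.symm]
      conv_lhs => rw [← Finset.insert_erase hx]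
      exact (Finset.insert_erase hx).symm ▸ (by
        simpa [Finset.erase_insert_of_ne hxy.symm, hx] using
          mult_insert_nsmul_mult (S := S.erase x) (a := x) (b := a))

theorem exists_step_ne {A : Finset (Fin m → ℕ)} (h : ¬ IsFullyReduced A) :
    ∃ A', Step A A' ∧ A ≠ A' := by
  rw [isFullyReduced_iff] at h
  push Not at h
  obtain ⟨a, ha, h⟩ := h
  refine ⟨_, step_iff.2 ⟨a, ha, rfl⟩, fun e => ?_⟩
  have hm : a ∈ reduceAt (A.erase a) a := e ▸ ha
  by_cases hN : mult (A.erase a) a • a ∈ natSpan (A.erase a)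
  · simp [reduceAt_of_mem hN] at hm
  · rw [reduceAt_of_notMem hN] at hm
    have h1 : a = mult (A.erase a) a • a := by simpa using hm
    by_cases h2 : mult (A.erase a) a = 1
    · rw [← h1] at hN
      exact hN (h h2)
    · apply hN
      have : a = 0 := by
        ext j
        have h3 : a j = mult (A.erase a) a * a j := by simpa using congrFun h1 j
        by_contra h4
        exact h2 (Nat.eq_of_mul_eq_mul_right (Nat.pos_of_ne_zero h4) (by rw [← h3, one_mul]))
      simp [this]

theorem exists_isReductionOf (A : Finset (Fin m → ℕ)) : ∃ R, IsReductionOf A R := by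
  induction A using WellFounded.induction (InvImage.wf complexity wellFounded_lt) with
  | _ A ih =>
    by_cases h : IsFullyReduced A
    · exact ⟨A, .refl, h⟩
    · obtain ⟨A', h1, h2⟩ := exists_step_ne h
      obtain ⟨R, h3, h4⟩ := ih A' (complexity_lt h1 h2)
      exact ⟨R, .head h1 h3, h4⟩

/-- A step may leave the set unchanged, so idle steps are skipped before well-founded induction
applies. -/
theorem eq_or_exists_step_ne {A R : Finset (Fin m → ℕ)} (h : Relation.ReflTransGen Step A R) :
    A = R ∨ ∃ A', Step A A' ∧ A ≠ A' ∧ Relation.ReflTransGen Step A' R := by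
  induction h using Relation.ReflTransGen.head_induction_on with
  | refl => exact Or.inl rfl
  | @head A A' h h' ih =>
    by_cases e : A = A'
    · subst e; exact ih
    · exact Or.inr ⟨A', h, e, h'⟩

theorem not_step_ne_of_isFullyReduced {A A' : Finset (Fin m → ℕ)} (hA : IsFullyReduced A)
    (h : Step A A') : A = A' := by
  obtain ⟨a, ha, rfl⟩ := step_iff.1 h
  obtain ⟨h1, h2⟩ := isFullyReduced_iff.1 hA a ha
  rw [reduceAt_of_notMem (by rwa [h1, one_smul]), h1, one_smul, Finset.insert_erase ha]

/-- Newman's lemma: join the two first steps at `D`, reduce `D` fully, and apply induction to both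
sides. -/
theorem isReductionOf_unique {A R₁ R₂ : Finset (Fin m → ℕ)} (h₁ : IsReductionOf A R₁)
    (h₂ : IsReductionOf A R₂) : R₁ = R₂ := by
  induction A using WellFounded.induction (InvImage.wf complexity wellFounded_lt)
    generalizing R₁ R₂ with
  | _ A ih =>
    rcases eq_or_exists_step_ne h₁.1 with rfl | ⟨A₁, s₁, n₁, t₁⟩
    · rcases eq_or_exists_step_ne h₂.1 with rfl | ⟨A₂, s₂, n₂, t₂⟩
      · rfl
      · exact absurd (not_step_ne_of_isFullyReduced h₁.2 s₂) n₂
    rcases eq_or_exists_step_ne h₂.1 with rfl | ⟨A₂, s₂, n₂, t₂⟩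
    · exact absurd (not_step_ne_of_isFullyReduced h₂.2 s₁) n₁
    obtain ⟨D, d₁, d₂⟩ := step_locally_confluent s₁ s₂
    obtain ⟨R, hR, hR'⟩ := exists_isReductionOf D
    rw [ih A₁ (complexity_lt s₁ n₁) ⟨t₁, h₁.2⟩ ⟨d₁.trans hR, hR'⟩,
      ih A₂ (complexity_lt s₂ n₂) ⟨t₂, h₂.2⟩ ⟨d₂.trans hR, hR'⟩]

end ToricReduction

/-! ### Heights and numbers of generators in `R[X]`. -/

namespace ToricReduction

open Polynomial in
/-- If `C h` lies in the ideal generated by a monic non-constant polynomial and by `J`, then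
`h ∈ J`. -/
theorem mem_of_C_mem_span_monic_sup {R : Type*} [CommRing R] {J : Ideal R} {q : R[X]}
    (hq : q.Monic) (hd : 0 < q.natDegree) {h : R}
    (hh : C h ∈ Ideal.span {q} ⊔ J.map C) : h ∈ J := by
  rw [Submodule.mem_sup] at hh
  obtain ⟨y, hy, z, hz, e⟩ := hh
  obtain ⟨p, rfl⟩ := Ideal.mem_span_singleton.1 hy
  rw [← Ideal.Quotient.eq_zero_iff_mem]
  by_contra hne
  have : Nontrivial (R ⧸ J) := ⟨_, _, hne⟩
  have hz0 : z.map (Ideal.Quotient.mk J) = 0 := by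
    ext n
    rw [coeff_map, coeff_zero, Ideal.Quotient.eq_zero_iff_mem]
    exact Ideal.mem_map_C_iff.1 hz n
  -- Over `R ⧸ J`, a monic polynomial of positive degree would divide a nonzero constant.
  have e' := congrArg (Polynomial.map (Ideal.Quotient.mk J)) e
  rw [Polynomial.map_add, hz0, add_zero, Polynomial.map_mul, map_C] at e'
  refine (hq.map (Ideal.Quotient.mk J)).not_dvd_of_natDegree_lt (q := C (Ideal.Quotient.mk J h))
    (by simpa using hne) ?_ ⟨_, e'.symm⟩
  rw [natDegree_C, hq.natDegree_map]
  exact hd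

section Height

open Polynomial Ideal

/-- `Q` survives inverting the nonzero constants, and a polynomial ring in one variable over a field
has dimension 1. -/
theorem height_eq_one_of_comap_C_eq_bot {D : Type*} [CommRing D] [IsDomain D] [IsNoetherianRing D]
    (Q : Ideal D[X]) [Q.IsPrime] (h0 : Q ≠ ⊥) (hc : Q.comap C = ⊥) : Q.height = 1 := by
  let _ := Polynomial.algebra D (FractionRing D)
  have := Polynomial.isLocalization (nonZeroDivisors D) (FractionRing D)
  have disj : Disjoint ((nonZeroDivisors D).map (C : D →+* D[X]) : Set D[X]) Q := by
    refine Set.disjoint_left.mpr ?_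
    rintro _ ⟨b, hb, rfl⟩ ha
    have : b ∈ Q.comap C := ha
    rw [hc, Ideal.mem_bot] at this
    exact nonZeroDivisors.ne_zero hb this
  have hprime : (Q.map (algebraMap D[X] (FractionRing D)[X])).IsPrime :=
    IsLocalization.isPrime_of_isPrime_disjoint ((nonZeroDivisors D).map (C : D →+* D[X])) _ Q ‹_›
      disj
  refine le_antisymm ?_ ?_
  · rw [← IsLocalization.height_map_of_disjoint
      ((nonZeroDivisors D).map (C : D →+* D[X])) (S := (FractionRing D)[X]) Q disj]
    have := Ideal.height_le_ringKrullDim_of_ne_top hprime.ne_top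
    rw [Polynomial.ringKrullDim_of_isNoetherianRing, ringKrullDim_eq_zero_of_field, zero_add]
      at this
    exact_mod_cast this
  · have := Ideal.height_add_one_le_of_lt_of_isPrime (bot_lt_iff_ne_bot.2 h0)
    rwa [Ideal.height_bot, zero_add] at this

variable {R : Type*} [CommRing R] [IsNoetherianRing R]

theorem height_map_C_of_isPrime (p : Ideal R) [p.IsPrime] :
    (p.map (C : R →+* R[X])).height = p.height := by
  have : (p.map (C : R →+* R[X])).IsPrime := Ideal.isPrime_map_C_of_isPrime
  have : (p.map (C : R →+* R[X])).LiesOver p := ⟨by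
    ext x
    change x ∈ p ↔ C x ∈ p.map (C : R →+* R[X])
    rw [Ideal.mem_map_C_iff]
    refine ⟨fun h n => ?_, fun h => by simpa using h 0⟩
    rw [coeff_C]
    split_ifs
    exacts [h, zero_mem _]⟩
  rw [height_eq_height_add_of_liesOver_of_hasGoingDown p, Polynomial.algebraMap_eq,
    Ideal.map_quotient_self, Ideal.height_bot, add_zero]

/-- By going down, the height of `P` is that of `p` plus that of the image of `P` in `(R ⧸ p)[X]`, a
nonzero prime contracting to zero. -/
theorem height_eq_height_comap_C_add_one (p : Ideal R) [p.IsPrime] (P : Ideal R[X]) [P.IsPrime]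
    (hp : P.comap C = p) (hne : P ≠ p.map C) : P.height = p.height + 1 := by
  have : P.LiesOver p := ⟨hp.symm⟩
  rw [height_eq_height_add_of_liesOver_of_hasGoingDown p P, Polynomial.algebraMap_eq]
  congr 1
  have hle : p.map C ≤ P := by rw [← hp]; exact Ideal.map_comap_le
  let e := (polynomialQuotientEquivQuotientPolynomial p).symm
  have hpr : (P.map (Ideal.Quotient.mk (p.map C))).IsPrime :=
    Ideal.map_isPrime_of_surjective Ideal.Quotient.mk_surjective (by rwa [Ideal.mk_ker])
  rw [← RingEquiv.height_map e]
  have : ((P.map (Ideal.Quotient.mk (p.map C))).map e).IsPrime := Ideal.map_isPrime_of_equiv e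
  have key : ∀ f : R[X], e (Ideal.Quotient.mk (p.map C) f) = f.map (Ideal.Quotient.mk p) :=
    fun f => polynomialQuotientEquivQuotientPolynomial_symm_mk p f
  have hker : ∀ f : R[X], f.map (Ideal.Quotient.mk p) = 0 ↔ f ∈ p.map C := by
    intro f
    rw [← key, EmbeddingLike.map_eq_zero_iff, Ideal.Quotient.eq_zero_iff_mem]
  have hmem : ∀ f : R[X], f.map (Ideal.Quotient.mk p) ∈ (P.map (Ideal.Quotient.mk (p.map C))).map e
      ↔ f ∈ P := by
    intro f
    rw [← key, ← Ideal.comap_symm, Ideal.mem_comap, RingEquiv.symm_apply_apply,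
      Ideal.mem_quotient_iff_mem hle]
  refine height_eq_one_of_comap_C_eq_bot _ ?_ ?_
  · intro h
    refine hne (le_antisymm (fun f hf => ?_) hle)
    rw [← hmem, h, Ideal.mem_bot, hker] at hf
    exact hf
  · rw [eq_bot_iff]
    intro x hx
    obtain ⟨x, rfl⟩ := Ideal.Quotient.mk_surjective x
    rw [Ideal.mem_comap, ← map_C, hmem] at hx
    rw [Ideal.mem_bot, Ideal.Quotient.eq_zero_iff_mem, ← hp]
    exact hx

end Height

section SpanFinrank

open Polynomial

variable {R : Type*} [CommRing R]

/-- Generators are carried forward by `C` and back by evaluation at 0. -/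
theorem spanFinrank_map_C {I : Ideal R} (hI : I.FG) :
    (I.map (C : R →+* R[X])).spanFinrank = I.spanFinrank := by
  refine le_antisymm (Ideal.spanFinrank_map_le_of_fg _ hI) ?_
  have := Ideal.spanFinrank_map_le_of_fg (evalRingHom (0 : R)) (I := I.map C) (hI.map _)
  have hid : (evalRingHom (0 : R)).comp C = RingHom.id R := by ext x; simp
  rwa [Ideal.map_map, hid, Ideal.map_id] at this

theorem spanFinrank_le_card {I : Ideal R} (s : Finset R) (h : Ideal.span (s : Set R) = I) :
    I.spanFinrank ≤ s.card := by
  rw [← h, ← Set.ncard_coe_finset]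
  exact Submodule.spanFinrank_span_le_ncard_of_finite s.finite_toSet

end SpanFinrank

end ToricReduction

/-! ### Minimal binomial generators. -/

namespace ToricReduction

open MvPolynomial

variable {k : Type*} [Field k] {m : ℕ} {σ : Type*}

/-- The exponent vector of a tuple. -/
noncomputable abbrev expo (d : Fin m → ℕ) : Fin m →₀ ℕ := Finsupp.equivFunOnFinite.symm d

variable (k) in
/-- The homomorphism `x_s ↦ t^{v_s}` attached to a family of vectors. -/
noncomputable def toricHom (v : σ → Fin m → ℕ) : MvPolynomial σ k →ₐ[k] MvPolynomial (Fin m) k :=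
  aeval fun s => ∏ j : Fin m, (X j : MvPolynomial (Fin m) k) ^ v s j

variable (k) in
/-- The toric ideal of a family of vectors. -/
noncomputable def familyIdeal (v : σ → Fin m → ℕ) : Ideal (MvPolynomial σ k) :=
  RingHom.ker (toricHom k v)

/-- The degree `∑ u_s v_s ∈ ℕ^m` of an exponent `u`. -/
noncomputable abbrev deg (v : σ → Fin m → ℕ) (u : σ →₀ ℕ) : Fin m → ℕ :=
  Finsupp.linearCombination ℕ v u

theorem prod_X_pow_eq_monomial (d : Fin m → ℕ) :
    ∏ j : Fin m, (X j : MvPolynomial (Fin m) k) ^ d j = monomial (expo d) 1 := by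
  rw [monomial_eq, C_1, one_mul, Finsupp.prod_fintype _ _ (by simp)]
  rfl

theorem expo_add (d e : Fin m → ℕ) : expo (d + e) = expo d + expo e := by
  ext j; simp

theorem expo_nsmul (n : ℕ) (d : Fin m → ℕ) : expo (n • d) = n • expo d := by
  ext j; simp

theorem toricHom_monomial (v : σ → Fin m → ℕ) (u : σ →₀ ℕ) (c : k) :
    toricHom k v (monomial u c) = monomial (expo (deg v u)) c := by
  suffices h : toricHom k v (monomial u 1) = monomial (expo (deg v u)) 1 by
    have := C_mul_monomial (s := u) (a := c) (a' := (1 : k))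
    rw [mul_one] at this
    rw [← this, map_mul, h, ← algebraMap_eq, AlgHom.commutes, algebraMap_eq, C_mul_monomial,
      mul_one]
  induction u using Finsupp.induction_linear with
  | zero =>
    rw [deg, map_zero, show expo (0 : Fin m → ℕ) = 0 by ext; simp]
    exact map_one _
  | add f g hf hg =>
    rw [deg, map_add, expo_add, ← one_mul (1 : k), ← monomial_mul, ← monomial_mul, map_mul, hf, hg]
  | single s n =>
    rw [← X_pow_eq_monomial, map_pow, toricHom, aeval_X, prod_X_pow_eq_monomial, monomial_pow,
      one_pow, deg, Finsupp.linearCombination_single, expo_nsmul]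

theorem monomial_sub_monomial_mem_familyIdeal {v : σ → Fin m → ℕ} {u w : σ →₀ ℕ} :
    monomial u (1 : k) - monomial w 1 ∈ familyIdeal k v ↔ deg v u = deg v w := by
  rw [familyIdeal, RingHom.mem_ker, map_sub, sub_eq_zero, toricHom_monomial, toricHom_monomial,
    monomial_left_inj one_ne_zero, Equiv.apply_eq_iff_eq]

/-- The binomials, differences of two monomials, in an ideal. -/
def binomials (I : Ideal (MvPolynomial σ k)) : Set (MvPolynomial σ k) :=
  {p | p ∈ I ∧ ∃ u w : σ →₀ ℕ, p = monomial u 1 - monomial w 1}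

/-- Choose one exponent `rep` in each degree. Replacing every monomial by its representative changes
a polynomial by binomials of the ideal, and sends elements of the kernel to 0. -/
theorem familyIdeal_le_span_binomials (v : σ → Fin m → ℕ) {p : MvPolynomial σ k}
    (hp : p ∈ familyIdeal k v) : p ∈ Submodule.span k (binomials (familyIdeal k v)) := by
  let rep : (Fin m →₀ ℕ) → (σ →₀ ℕ) := Function.invFun fun u => expo (deg v u)
  have hrep : ∀ u, deg v (rep (expo (deg v u))) = deg v u := fun u =>
    Finsupp.equivFunOnFinite.symm.injective
      (Function.invFun_eq (f := fun u => expo (deg v u)) ⟨u, rfl⟩)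
  let L : MvPolynomial (Fin m) k →ₗ[k] MvPolynomial σ k :=
    (basisMonomials (Fin m) k).constr k fun d => monomial (rep d) (1 : k)
  have hL : ∀ d (c : k), L (monomial d c) = monomial (rep d) c := by
    intro d c
    have h1 : monomial d c = c • basisMonomials (Fin m) k d := by simp [smul_monomial]
    rw [h1, map_smul, Module.Basis.constr_basis, smul_monomial, smul_eq_mul, mul_one]
  have key : ∀ q : MvPolynomial σ k,
      q - L (toricHom k v q) ∈ Submodule.span k (binomials (familyIdeal k v)) := by
    intro q
    induction q using MvPolynomial.induction_on' with
    | monomial u c =>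
      rw [toricHom_monomial, hL]
      have : monomial u c - monomial (rep (expo (deg v u))) c =
          c • (monomial u (1 : k) - monomial (rep (expo (deg v u))) 1) := by
        simp [smul_sub, smul_monomial]
      rw [this]
      exact Submodule.smul_mem _ _ (Submodule.subset_span
        ⟨monomial_sub_monomial_mem_familyIdeal.2 (hrep u).symm, _, _, rfl⟩)
    | add p q hp hq =>
      rw [map_add, map_add, add_sub_add_comm]
      exact add_mem hp hq
  have := key p
  rwa [show toricHom k v p = 0 from hp, map_zero, sub_zero] at this

section Nakayama

attribute [local instance] MvPolynomial.weightedGradedAlgebra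

/-- The graded Nakayama lemma for toric ideals of nonzero vectors. -/
theorem span_eq_familyIdeal_of_le_sup [Finite σ] {v : σ → Fin m → ℕ} (hv : ∀ s, v s ≠ 0)
    {G : Set (MvPolynomial σ k)} (hG : G ⊆ binomials (familyIdeal k v))
    (h : familyIdeal k v ≤
      Ideal.span G ⊔ RingHom.ker (constantCoeff (σ := σ) (R := k)) * familyIdeal k v) :
    Ideal.span G = familyIdeal k v := by
  refine le_antisymm (Ideal.span_le.2 fun x hx => (hG hx).1) ?_
  -- These weights are positive because `v s ≠ 0`, and they make the binomials of the ideal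
  -- homogeneous.
  let wt : σ → ℕ := fun s => ∑ j, v s j
  have hwt : ∀ s, wt s ≠ 0 := by
    intro s h0
    exact hv s (funext fun j => Finset.sum_eq_zero_iff.1 h0 j (Finset.mem_univ j))
  have hweight : ∀ u, Finsupp.weight wt u = ∑ j, deg v u j := by
    intro u
    have := Finsupp.apply_linearCombination ℕ (∑ j : Fin m, LinearMap.proj (φ := fun _ => ℕ) j) v u
    rw [LinearMap.sum_apply] at this
    change Finsupp.linearCombination ℕ wt u = _
    refine Eq.trans ?_ this.symm
    congr 2
    ext s
    simp [wt]
  have hhom : ∀ p ∈ binomials (familyIdeal k v),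
      ∃ d, p ∈ weightedHomogeneousSubmodule k wt d := by
    rintro _ ⟨hp, u, w, rfl⟩
    rw [monomial_sub_monomial_mem_familyIdeal] at hp
    refine ⟨∑ j, deg v u j, sub_mem ?_ ?_⟩
    · exact isWeightedHomogeneous_monomial _ _ _ (hweight u)
    · exact isWeightedHomogeneous_monomial _ _ _ (by rw [hweight, hp])
  have hJ : (Ideal.span G).IsHomogeneous (weightedHomogeneousSubmodule k wt) :=
    Ideal.homogeneous_span _ _ fun x hx => hhom x (hG hx)
  obtain ⟨r, hr1, hr⟩ := Submodule.exists_sub_one_mem_and_smul_eq_zero_of_fg_of_le_smul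
    (RingHom.ker (constantCoeff (σ := σ) (R := k)))
    (Submodule.map (Submodule.mkQ (Ideal.span G)) (familyIdeal k v))
    ((IsNoetherian.noetherian (familyIdeal k v)).map _) (by
      rw [← Submodule.map_smul'']
      refine (Submodule.map_mono h).trans ?_
      rw [Submodule.map_sup, Submodule.mkQ_map_self, bot_sup_eq]
      rfl)
  have hr0 : coeff 0 r = 1 := by
    rw [RingHom.mem_ker, map_sub, map_one, sub_eq_zero] at hr1
    exact hr1
  have hbin : binomials (familyIdeal k v) ⊆ Ideal.span G := by
    intro f hf
    obtain ⟨d, hd⟩ := hhom f hf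
    have h1 : r * f ∈ Ideal.span G := by
      have := hr _ (Submodule.mem_map_of_mem hf.1)
      rw [← map_smul, Submodule.mkQ_apply, Submodule.Quotient.mk_eq_zero] at this
      exact this
    have h2 := hJ d h1
    -- The component of `r * f` in the degree of `f` is `f` times the weight-zero part of `r`, its
    -- constant term 1.
    rw [DirectSum.coe_decompose_mul_of_right_mem_of_le _ hd le_rfl, Nat.sub_self] at h2
    have h3 : ((DirectSum.decompose (weightedHomogeneousSubmodule k wt) r) 0 :
        MvPolynomial σ k) = 1 := by
      refine (weightedDecomposition.decompose'_apply k wt r 0).trans ?_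
      rw [weightedHomogeneousComponent_zero r hwt, hr0, C_1]
    rwa [h3, one_mul] at h2
  intro p hp
  have h1 := familyIdeal_le_span_binomials v hp
  have h2 : Submodule.span k (binomials (familyIdeal k v)) ≤
      (Ideal.span G).restrictScalars k := Submodule.span_le.2 hbin
  exact h2 h1

end Nakayama

/-- A toric ideal has a minimal generating set that consists of binomials. Moreover a binomial
outside `𝔪 I` can be prescribed. -/
theorem exists_binomial_generators [Finite σ] {v : σ → Fin m → ℕ} (hv : ∀ s, v s ≠ 0)
    {t : Set (MvPolynomial σ k)} (ht : t ⊆ binomials (familyIdeal k v))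
    (hti : t = ∅ ∨ ∃ g, t = {g} ∧
      g ∉ RingHom.ker (constantCoeff (σ := σ) (R := k)) * familyIdeal k v) :
    ∃ G : Finset (MvPolynomial σ k), t ⊆ G ∧ (G : Set _) ⊆ binomials (familyIdeal k v) ∧
      Ideal.span (G : Set (MvPolynomial σ k)) = familyIdeal k v ∧
      G.card ≤ (familyIdeal k v).spanFinrank := by
  set I := familyIdeal k v
  let 𝔪 : Ideal (MvPolynomial σ k) := RingHom.ker (constantCoeff (σ := σ) (R := k))
  let q : MvPolynomial σ k →ₗ[k] MvPolynomial σ k ⧸ (𝔪 * I) :=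
    (Ideal.Quotient.mkₐ k (𝔪 * I)).toLinearMap
  have hq : ∀ x, q x = 0 ↔ x ∈ 𝔪 * I := fun x => Ideal.Quotient.eq_zero_iff_mem
  have hlin : LinearIndepOn k q t := by
    rcases hti with rfl | ⟨g, rfl, hg⟩
    · exact linearIndepOn_empty _ _
    · rw [linearIndepOn_singleton_iff]
      exact fun h => hg ((hq g).1 h)
  -- Extend `t` by binomials to a basis of `I / 𝔪I` over `k`; by Nakayama it generates `I`.
  obtain ⟨b, hb, htb, hspan, hbi⟩ := exists_linearIndepOn_extension hlin ht
  obtain ⟨s, hs, hsI⟩ := (IsNoetherian.noetherian I).exists_span_finset_card_eq_spanFinrank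
  have hIs : ∀ x ∈ I, q x ∈ Submodule.span k (q '' (s : Set (MvPolynomial σ k))) := by
    intro x hx
    rw [← hsI] at hx
    induction hx using Submodule.span_induction with
    | mem x hx => exact Submodule.subset_span ⟨x, hx, rfl⟩
    | zero => simp
    | add x y _ _ hx hy => rw [map_add]; exact add_mem hx hy
    | smul a x hx' hx =>
      -- Modulo `𝔪 I` a polynomial acts through its constant term, so ideal generators of `I` span
      -- `I / 𝔪I` over `k`.
      have : q (a • x) = constantCoeff a • q x := by
        rw [← map_smul, ← sub_eq_zero, ← map_sub, hq, smul_eq_C_mul, smul_eq_mul, ← sub_mul]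
        refine Ideal.mul_mem_mul ?_ (by rw [← hsI]; exact hx')
        simp [𝔪, RingHom.mem_ker]
      rw [this]
      exact Submodule.smul_mem _ _ hx
  let V := Submodule.span k (q '' (s : Set (MvPolynomial σ k)))
  have hfinV : Module.Finite k V := Module.Finite.span_of_finite k (s.finite_toSet.image _)
  have hli : LinearIndependent k fun x : b => (⟨q x, hIs x (hb x.2).1⟩ : V) := by
    refine LinearIndependent.of_comp V.subtype ?_
    exact hbi
  have hfin : Finite b := hli.finite
  have hcard : Nat.card b ≤ I.spanFinrank := by
    have := Fintype.ofFinite b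
    rw [Nat.card_eq_fintype_card, ← hs]
    refine hli.fintype_card_le_finrank.trans ?_
    classical
    have := finrank_span_finset_le_card (R := k) (s.image q)
    rw [Finset.coe_image] at this
    exact this.trans Finset.card_image_le
  have hbf : b.Finite := hfin
  refine ⟨hbf.toFinset, by simpa using htb, by simpa using hb, ?_, ?_⟩
  · rw [hbf.coe_toFinset]
    refine span_eq_familyIdeal_of_le_sup hv hb ?_
    intro x hx
    have h1 := familyIdeal_le_span_binomials v hx
    have h2 : q x ∈ Submodule.span k (q '' b) := by
      have : q x ∈ Submodule.map q (Submodule.span k (binomials I)) := ⟨x, h1, rfl⟩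
      rw [Submodule.map_span] at this
      exact (Submodule.span_le.2 hspan) this
    rw [← Submodule.map_span] at h2
    obtain ⟨y, hy, e⟩ := h2
    have hyG : y ∈ Ideal.span b := by
      have : Submodule.span k b ≤ (Ideal.span b).restrictScalars k :=
        Submodule.span_le.2 Ideal.subset_span
      exact this hy
    have hxy : x - y ∈ 𝔪 * I := by rw [← hq, map_sub, e, sub_self]
    exact Submodule.mem_sup.2 ⟨y, hyG, x - y, hxy, add_sub_cancel y x⟩
  · rw [← Set.ncard_eq_toFinset_card b hbf]
    exact hcard

end ToricReduction

/-! ### The toric ideal of `S ∪ {a}` inside `k[x_s : s ∈ S][X]`. -/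

namespace ToricReduction

open MvPolynomial hiding C X

variable {k : Type*} [Field k] {m : ℕ}

theorem deg_mem_natSpan (S : Finset (Fin m → ℕ)) (u : S →₀ ℕ) :
    deg (Subtype.val : S → Fin m → ℕ) u ∈ natSpan S := by
  rw [deg, Finsupp.linearCombination_apply]
  exact sum_mem fun s _ => nsmul_mem (mem_natSpan_of_mem s.2) _

theorem exists_deg_eq {S : Finset (Fin m → ℕ)} {x : Fin m → ℕ} (hx : x ∈ natSpan S) :
    ∃ u, deg (Subtype.val : S → Fin m → ℕ) u = x := by
  induction hx using AddSubmonoid.closure_induction with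
  | mem x hx => exact ⟨Finsupp.single ⟨x, hx⟩ 1, by simp [deg]⟩
  | zero => exact ⟨0, map_zero _⟩
  | add x y _ _ hx hy =>
    obtain ⟨u, rfl⟩ := hx
    obtain ⟨w, rfl⟩ := hy
    exact ⟨u + w, map_add _ _ _⟩

theorem exists_toInt_deg_sub_eq {S : Finset (Fin m → ℕ)} {x : Fin m → ℤ} (hx : x ∈ intSpan S) :
    ∃ u w : S →₀ ℕ, toInt (deg Subtype.val u) - toInt (deg Subtype.val w) = x := by
  induction hx using AddSubgroup.closure_induction with
  | mem x hx =>
    obtain ⟨a, ha, rfl⟩ := hx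
    obtain ⟨u, rfl⟩ := exists_deg_eq (mem_natSpan_of_mem ha)
    exact ⟨u, 0, by rw [deg, deg, map_zero, map_zero, sub_zero]; rfl⟩
  | zero => exact ⟨0, 0, sub_self _⟩
  | add x y _ _ hx hy =>
    obtain ⟨u, w, rfl⟩ := hx
    obtain ⟨u', w', rfl⟩ := hy
    exact ⟨u + u', w + w', by simp only [deg, map_add]; abel⟩
  | neg x _ hx =>
    obtain ⟨u, w, rfl⟩ := hx
    exact ⟨w, u, (neg_sub _ _).symm⟩

/-- Since `(j - i) a ∈ ℤS`, the exponents agree modulo the order of `a`, and the common remainder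
`r` cancels. For order `0` this says `i = j = r`. -/
theorem mult_dvd_of_relation {S : Finset (Fin m → ℕ)} {a : Fin m → ℕ} {i j : ℕ} {u w : S →₀ ℕ}
    (h : i • a + deg Subtype.val u = j • a + deg Subtype.val w) :
    ∃ r p p', i = mult S a * p + r ∧ j = mult S a * p' + r ∧
      p • (mult S a • a) + deg Subtype.val u = p' • (mult S a • a) + deg Subtype.val w := by
  have h1 : (mult S a : ℤ) ∣ (j : ℤ) - i := by
    rw [mult_dvd_iff, sub_smul, ← toInt_nsmul, ← toInt_nsmul]
    have e : toInt (j • a) - toInt (i • a) =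
        toInt (deg Subtype.val u) - toInt (deg Subtype.val w) := by
      have h2 : toInt (i • a) + toInt (deg Subtype.val u) =
        toInt (j • a) + toInt (deg Subtype.val w) := by rw [← map_add, h, map_add]
      rw [sub_eq_sub_iff_add_eq_add, ← h2, add_comm]
    rw [e]
    exact sub_mem (toInt_mem_intSpan (deg_mem_natSpan S u))
      (toInt_mem_intSpan (deg_mem_natSpan S w))
  have h2 : i % mult S a = j % mult S a := (Nat.modEq_iff_dvd.2 h1)
  have hi : i = mult S a * (i / mult S a) + i % mult S a := (Nat.div_add_mod _ _).symm
  have hj : j = mult S a * (j / mult S a) + i % mult S a := by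
    rw [h2]; exact (Nat.div_add_mod _ _).symm
  refine ⟨_, _, _, hi, hj, ?_⟩
  rw [hi, hj, add_smul, add_smul, add_right_comm, add_right_comm (_ • a) _ (deg _ w),
    add_left_inj] at h
  rwa [smul_smul, smul_smul, mul_comm, mul_comm (j / _)]

section StepIdeal

open Polynomial (C X)

variable (k) (S : Finset (Fin m → ℕ)) (a : Fin m → ℕ)

/-- The homomorphism `k[x_s : s ∈ S][X] → k[t]` with `x_s ↦ t^s` and `X ↦ t^a`. -/
noncomputable def stepHom : Polynomial (MvPolynomial S k) →+* MvPolynomial (Fin m) k :=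
  Polynomial.eval₂RingHom (toricHom k (Subtype.val : S → Fin m → ℕ)).toRingHom
    (monomial (expo a) 1)

/-- The toric ideal of `S ∪ {a}`, in `k[x_s : s ∈ S][X]`. -/
noncomputable def stepIdeal : Ideal (Polynomial (MvPolynomial S k)) :=
  RingHom.ker (stepHom k S a)

/-- The monomial `x^u X^i`. -/
noncomputable abbrev mono (i : ℕ) (u : S →₀ ℕ) : Polynomial (MvPolynomial S k) :=
  Polynomial.monomial i (monomial u (1 : k))

variable {k S a}

theorem mono_eq (i : ℕ) (u : S →₀ ℕ) : mono k S i u = X ^ i * C (monomial u 1) := by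
  rw [Polynomial.X_pow_mul_C, Polynomial.C_mul_X_pow_eq_monomial]

theorem stepHom_C (p : MvPolynomial S k) :
    stepHom k S a (C p) = toricHom k (Subtype.val : S → Fin m → ℕ) p :=
  Polynomial.eval₂_C _ _

theorem stepHom_X : stepHom k S a X = monomial (expo a) 1 := Polynomial.eval₂_X _ _

theorem stepHom_mono (i : ℕ) (u : S →₀ ℕ) :
    stepHom k S a (mono k S i u) = monomial (expo (i • a + deg Subtype.val u)) 1 := by
  rw [mono_eq, map_mul, map_pow, stepHom_X, stepHom_C, toricHom_monomial, monomial_pow, one_pow,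
    monomial_mul, one_mul, expo_add, expo_nsmul]

theorem mono_sub_mono_mem_stepIdeal {i j : ℕ} {u w : S →₀ ℕ} :
    mono k S i u - mono k S j w ∈ stepIdeal k S a ↔
      i • a + deg Subtype.val u = j • a + deg Subtype.val w := by
  rw [stepIdeal, RingHom.mem_ker, map_sub, sub_eq_zero, stepHom_mono, stepHom_mono,
    monomial_left_inj one_ne_zero, Equiv.apply_eq_iff_eq]

theorem toricIdeal_eq_familyIdeal :
    toricIdeal k S = familyIdeal k (Subtype.val : S → Fin m → ℕ) := rfl

theorem comap_C_stepIdeal : (stepIdeal k S a).comap C = toricIdeal k S := by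
  ext p
  rw [Ideal.mem_comap, stepIdeal, RingHom.mem_ker, stepHom_C]
  rfl

instance isPrime_stepIdeal : (stepIdeal k S a).IsPrime := RingHom.ker_isPrime _

instance isPrime_toricIdeal : (toricIdeal k S).IsPrime := RingHom.ker_isPrime _

/-- The identification of the polynomial ring of `S ∪ {a}` with `k[x_s : s ∈ S][X]`. -/
noncomputable def insertEquiv (k : Type*) [Field k] (ha : a ∉ S) :
    MvPolynomial {x // x ∈ insert a S} k ≃ₐ[k] Polynomial (MvPolynomial S k) :=
  (renameEquiv k (Finset.subtypeInsertEquivOption ha)).trans (optionEquivLeft k S)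

theorem insertEquiv_monomial (ha : a ∉ S) (u : {x // x ∈ insert a S} →₀ ℕ) :
    insertEquiv k ha (monomial u 1) =
      mono k S (u.mapDomain (Finset.subtypeInsertEquivOption ha) none)
        (u.mapDomain (Finset.subtypeInsertEquivOption ha)).some := by
  rw [insertEquiv, AlgEquiv.trans_apply, renameEquiv_apply, rename_monomial,
    optionEquivLeft_monomial]

theorem exists_insertEquiv_monomial (ha : a ∉ S) (i : ℕ) (u : S →₀ ℕ) :
    ∃ u', insertEquiv k ha (monomial u' 1) = mono k S i u := by
  refine ⟨(u.optionElim i).mapDomain (Finset.subtypeInsertEquivOption ha).symm, ?_⟩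
  have : Finsupp.mapDomain (Finset.subtypeInsertEquivOption ha)
      ((u.optionElim i).mapDomain (Finset.subtypeInsertEquivOption ha).symm) = u.optionElim i := by
    rw [← Finsupp.mapDomain_comp, Equiv.self_comp_symm, Finsupp.mapDomain_id]
  rw [insertEquiv_monomial, this, Finsupp.optionElim_apply_none, Finsupp.some_optionElim]

theorem stepHom_insertEquiv (ha : a ∉ S) (p : MvPolynomial {x // x ∈ insert a S} k) :
    stepHom k S a (insertEquiv k ha p) =
      toricHom k (Subtype.val : {x // x ∈ insert a S} → Fin m → ℕ) p := by
  have : (stepHom k S a).comp (insertEquiv k ha : _ →+* _) =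
      (toricHom k (Subtype.val : {x // x ∈ insert a S} → Fin m → ℕ)).toRingHom := by
    refine MvPolynomial.ringHom_ext (fun c => ?_) (fun x => ?_)
    · have h1 : insertEquiv k ha (MvPolynomial.C c) = C (MvPolynomial.C c) := by
        simp [insertEquiv]
      change stepHom k S a (insertEquiv k ha (MvPolynomial.C c)) = toricHom k _ (MvPolynomial.C c)
      rw [h1, stepHom_C, toricHom, toricHom, aeval_C, aeval_C]
    · change stepHom k S a (insertEquiv k ha (MvPolynomial.X x)) = toricHom k _ (MvPolynomial.X x)
      rw [toricHom, aeval_X, prod_X_pow_eq_monomial]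
      obtain ⟨x, hx⟩ := x
      by_cases h : x = a
      · subst h
        simp [insertEquiv, Finset.subtypeInsertEquivOption, stepHom_X]
      · simp [insertEquiv, Finset.subtypeInsertEquivOption, h, stepHom_C, toricHom,
          prod_X_pow_eq_monomial]
  exact RingHom.congr_fun this p

theorem comap_insertEquiv_stepIdeal (ha : a ∉ S) :
    (stepIdeal k S a).comap (insertEquiv k ha).toRingEquiv = toricIdeal k (insert a S) := by
  ext p
  change stepHom k S a (insertEquiv k ha p) = 0 ↔ _
  rw [stepHom_insertEquiv]
  rfl

theorem map_insertEquiv_toricIdeal (ha : a ∉ S) :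
    (toricIdeal k (insert a S)).map (insertEquiv k ha).toRingEquiv = stepIdeal k S a := by
  rw [← comap_insertEquiv_stepIdeal ha]
  exact Ideal.map_comap_of_surjective _ (insertEquiv k ha).surjective _

theorem height_toricIdeal_insert (ha : a ∉ S) :
    (toricIdeal k (insert a S)).height = (stepIdeal k S a).height := by
  rw [← map_insertEquiv_toricIdeal ha, RingEquiv.height_map]

theorem spanFinrank_toricIdeal_insert (ha : a ∉ S) :
    (toricIdeal k (insert a S)).spanFinrank = (stepIdeal k S a).spanFinrank := by
  rw [← map_insertEquiv_toricIdeal ha, Ideal.spanFinrank_map_eq_of_ringEquiv]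

/-- The version of `exists_binomial_generators` for `stepIdeal`. -/
theorem exists_mono_generators (ha : a ∉ S) (h0 : 0 ∉ insert a S)
    {t : Set (Polynomial (MvPolynomial S k))}
    (ht : ∀ g ∈ t, g ∈ stepIdeal k S a ∧ ∃ i u j w, g = mono k S i u - mono k S j w)
    (hti : t = ∅ ∨ ∃ g, t = {g} ∧
      g ∉ RingHom.ker (constantCoeff.comp Polynomial.constantCoeff :
        Polynomial (MvPolynomial S k) →+* k) * stepIdeal k S a) :
    ∃ G : Finset (Polynomial (MvPolynomial S k)), t ⊆ G ∧
      (∀ g ∈ G, g ∈ stepIdeal k S a ∧ ∃ i u j w, g = mono k S i u - mono k S j w) ∧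
      Ideal.span (G : Set (Polynomial (MvPolynomial S k))) = stepIdeal k S a ∧
      G.card ≤ (stepIdeal k S a).spanFinrank := by
  classical
  let E := insertEquiv k ha
  have hmem : ∀ p, E p ∈ stepIdeal k S a ↔ p ∈ toricIdeal k (insert a S) := by
    intro p
    rw [← comap_insertEquiv_stepIdeal ha]
    rfl
  have hv : ∀ s : {x // x ∈ insert a S}, (s : Fin m → ℕ) ≠ 0 := fun s h => h0 (h ▸ s.2)
  have hconst : ∀ p, constantCoeff (Polynomial.constantCoeff (E p)) = constantCoeff p := by
    intro p
    have : (constantCoeff.comp Polynomial.constantCoeff :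
        Polynomial (MvPolynomial S k) →+* k).comp
          (E : MvPolynomial {x // x ∈ insert a S} k →+* _) = constantCoeff := by
      refine MvPolynomial.ringHom_ext (fun c => by simp [E, insertEquiv]) (fun x => ?_)
      obtain ⟨x, hx⟩ := x
      by_cases h : x = a
      · subst h
        simp [E, insertEquiv, Finset.subtypeInsertEquivOption]
      · simp [E, insertEquiv, Finset.subtypeInsertEquivOption, h]
    exact RingHom.congr_fun this p
  have hmul : ∀ p ∈ RingHom.ker (constantCoeff (σ := {x // x ∈ insert a S}) (R := k)) *
      toricIdeal k (insert a S), E p ∈ RingHom.ker (constantCoeff.comp Polynomial.constantCoeff :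
        Polynomial (MvPolynomial S k) →+* k) * stepIdeal k S a := by
    intro p hp
    refine Submodule.mul_induction_on hp (fun x hx y hy => ?_) (fun x y hx hy => ?_)
    · rw [map_mul]
      refine Ideal.mul_mem_mul ?_ ((hmem y).2 hy)
      rw [RingHom.mem_ker] at hx ⊢
      exact (hconst x).trans hx
    · rw [map_add]; exact add_mem hx hy
  obtain ⟨G, h1, h2, h3, h4⟩ := exists_binomial_generators (k := k) hv (t := E.symm '' t) (by
      rintro _ ⟨g, hg, rfl⟩
      obtain ⟨hg1, i, u, j, w, rfl⟩ := ht g hg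
      refine ⟨(hmem _).1 (by rwa [AlgEquiv.apply_symm_apply]), ?_⟩
      obtain ⟨u', hu'⟩ := exists_insertEquiv_monomial (k := k) ha i u
      obtain ⟨w', hw'⟩ := exists_insertEquiv_monomial (k := k) ha j w
      exact ⟨u', w', by rw [← hu', ← hw', ← map_sub, AlgEquiv.symm_apply_apply]⟩) (by
      rcases hti with rfl | ⟨g, rfl, hg⟩
      · exact Or.inl (Set.image_empty _)
      · refine Or.inr ⟨E.symm g, Set.image_singleton, fun h => hg ?_⟩
        have := hmul _ h
        rwa [AlgEquiv.apply_symm_apply] at this)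
  refine ⟨G.image E, ?_, ?_, ?_, ?_⟩
  · intro g hg
    rw [Finset.coe_image]
    exact ⟨E.symm g, h1 ⟨g, hg, rfl⟩, E.apply_symm_apply g⟩
  · intro g hg
    obtain ⟨p, hp, rfl⟩ := Finset.mem_image.1 hg
    obtain ⟨hp1, u, w, rfl⟩ := h2 hp
    exact ⟨(hmem _).2 hp1, _, _, _, _, (map_sub E _ _).trans
      (congrArg₂ (· - ·) (insertEquiv_monomial ha u) (insertEquiv_monomial ha w))⟩
  · rw [Finset.coe_image, ← map_insertEquiv_toricIdeal ha, toricIdeal_eq_familyIdeal, ← h3,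
      Ideal.map_span]
    rfl
  · rw [← spanFinrank_toricIdeal_insert ha]
    exact Finset.card_image_le.trans h4

/-- Membership of a stepIdeal in another ideal can be tested on differences of monomials. -/
theorem stepIdeal_le (ha : a ∉ S) (h0 : 0 ∉ insert a S) {J : Ideal (Polynomial (MvPolynomial S k))}
    (h : ∀ i u j w, i • a + deg Subtype.val u = j • a + deg Subtype.val w →
      mono k S i u - mono k S j w ∈ J) : stepIdeal k S a ≤ J := by
  obtain ⟨G, -, hG, hspan, -⟩ := exists_mono_generators (k := k) ha h0 (t := ∅) (by simp)
    (Or.inl rfl)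
  rw [← hspan, Ideal.span_le]
  intro g hg
  obtain ⟨hg1, i, u, j, w, rfl⟩ := hG g hg
  exact h _ _ _ _ (mono_sub_mono_mem_stepIdeal.1 hg1)

end StepIdeal

end ToricReduction

/-! ### Effect of a step on the height and on the number of generators. -/

namespace ToricReduction

open MvPolynomial hiding C X
open Polynomial (C X)

variable {k : Type*} [Field k] {m : ℕ} {S : Finset (Fin m → ℕ)} {a : Fin m → ℕ}

theorem toInt_injective : Function.Injective (toInt : (Fin m → ℕ) → Fin m → ℤ) := by
  intro x y h
  ext j
  have := congrFun h j
  simpa [toInt] using this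

theorem map_C_toricIdeal_le : (toricIdeal k S).map C ≤ stepIdeal k S a := by
  rw [Ideal.map_le_iff_le_comap, comap_C_stepIdeal]

theorem stepIdeal_eq_map_C (ha : a ∉ S) (h0 : 0 ∉ insert a S) (hB : mult S a = 0) :
    stepIdeal k S a = (toricIdeal k S).map C := by
  refine le_antisymm (stepIdeal_le ha h0 fun i u j w h => ?_) map_C_toricIdeal_le
  obtain ⟨r, p, p', hi, hj, h'⟩ := mult_dvd_of_relation h
  rw [hB, zero_mul, zero_add] at hi hj
  rw [hB, zero_smul, smul_zero, smul_zero, zero_add, zero_add] at h'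
  rw [hi, hj, mono_eq, mono_eq, ← mul_sub, ← map_sub]
  exact Ideal.mul_mem_left _ _ (Ideal.mem_map_of_mem _ (monomial_sub_monomial_mem_familyIdeal.2 h'))

/-- Writing `B a` as a difference of elements of `ℕS` gives a binomial `X^B x^w - x^u`, whose
coefficient at `X^B` is a monomial; a toric ideal contains no monomial. -/
theorem stepIdeal_ne_map_C (hB : mult S a ≠ 0) : stepIdeal k S a ≠ (toricIdeal k S).map C := by
  intro h
  obtain ⟨u, w, e⟩ := exists_toInt_deg_sub_eq (mult_dvd_iff.1 (dvd_refl (mult S a : ℤ)))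
  have h1 : mult S a • a + deg Subtype.val w = 0 • a + deg Subtype.val u := by
    apply toInt_injective
    rw [map_add, toInt_nsmul, ← e, zero_smul, zero_add, sub_add_cancel]
  have h2 := mono_sub_mono_mem_stepIdeal (k := k).2 h1
  rw [h, Ideal.mem_map_C_iff] at h2
  have h3 := h2 (mult S a)
  rw [Polynomial.coeff_sub, Polynomial.coeff_monomial_same, Polynomial.coeff_monomial_of_ne _ hB,
    sub_zero, toricIdeal_eq_familyIdeal, familyIdeal, RingHom.mem_ker, toricHom_monomial,
    monomial_eq_zero] at h3
  exact one_ne_zero h3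

theorem height_stepIdeal (hB : mult S a ≠ 0) :
    (stepIdeal k S a).height = (toricIdeal k S).height + 1 :=
  height_eq_height_comap_C_add_one _ _ comap_C_stepIdeal (stepIdeal_ne_map_C hB)

theorem fg_toricIdeal : (toricIdeal k S).FG := IsNoetherian.noetherian _

section Redundant

variable {n : S →₀ ℕ}

/-- Replacing `X^B` by `x^n` turns a binomial into `X^r` times a binomial in the variables of `S`.
-/
theorem exists_sub_mem_span (hn : deg Subtype.val n = mult S a • a) {i j : ℕ} {u w : S →₀ ℕ}
    (h : i • a + deg Subtype.val u = j • a + deg Subtype.val w) :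
    ∃ r, ∃ g ∈ toricIdeal k S, mono k S i u - mono k S j w - X ^ r * C g ∈
      Ideal.span {X ^ mult S a - C (monomial n (1 : k))} := by
  obtain ⟨r, p, p', hi, hj, h'⟩ := mult_dvd_of_relation h
  refine ⟨r, monomial n 1 ^ p * monomial u 1 - monomial n 1 ^ p' * monomial w 1, ?_, ?_⟩
  · rw [monomial_pow, monomial_pow, one_pow, one_pow, monomial_mul, monomial_mul, one_mul]
    refine monomial_sub_monomial_mem_familyIdeal.2 ?_
    simp only [deg, map_add, map_nsmul] at *
    rw [hn]
    exact h'
  · set q : Polynomial (MvPolynomial S k) := X ^ mult S a - C (monomial n (1 : k))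
    have key : ∀ p : ℕ, q ∣ (X ^ mult S a) ^ p - C (monomial n (1 : k)) ^ p :=
      fun p => sub_dvd_pow_sub_pow _ _ p
    have e : mono k S i u - mono k S j w -
        X ^ r * C (monomial n 1 ^ p * monomial u 1 - monomial n 1 ^ p' * monomial w 1) =
        ((X ^ mult S a) ^ p - C (monomial n (1 : k)) ^ p) * (X ^ r * C (monomial u 1)) -
        ((X ^ mult S a) ^ p' - C (monomial n (1 : k)) ^ p') * (X ^ r * C (monomial w 1)) := by
      rw [mono_eq, mono_eq, hi, hj, map_sub, map_mul, map_mul, map_pow, map_pow]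
      ring
    rw [e, Ideal.mem_span_singleton]
    exact dvd_sub ((key p).mul_right _) ((key p').mul_right _)

theorem X_pow_sub_C_eq (B : ℕ) :
    (X ^ B - C (monomial n (1 : k)) : Polynomial (MvPolynomial S k)) =
      mono k S B 0 - mono k S 0 n := by
  rw [mono_eq, mono_eq, pow_zero, one_mul]
  congr 1
  exact (mul_one _).symm

theorem X_pow_sub_C_mem (hn : deg Subtype.val n = mult S a • a) :
    (X ^ mult S a - C (monomial n (1 : k))) ∈ stepIdeal k S a := by
  rw [X_pow_sub_C_eq, mono_sub_mono_mem_stepIdeal, hn, deg, map_zero, zero_smul, zero_add, add_zero]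

theorem stepIdeal_eq_sup (ha : a ∉ S) (h0 : 0 ∉ insert a S)
    (hn : deg Subtype.val n = mult S a • a) :
    stepIdeal k S a =
      (toricIdeal k S).map C ⊔ Ideal.span {X ^ mult S a - C (monomial n (1 : k))} := by
  refine le_antisymm (stepIdeal_le ha h0 fun i u j w h => ?_) (sup_le map_C_toricIdeal_le ?_)
  · obtain ⟨r, g, hg, h1⟩ := exists_sub_mem_span (k := k) hn h
    exact Submodule.mem_sup.2 ⟨X ^ r * C g, Ideal.mul_mem_left _ _ (Ideal.mem_map_of_mem _ hg),
      _, h1, add_sub_cancel _ _⟩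
  · rw [Ideal.span_singleton_le_iff_mem]
    exact X_pow_sub_C_mem hn

theorem constantCoeff_eq_zero_of_mem (h0 : 0 ∉ S) {p : MvPolynomial S k}
    (hp : p ∈ toricIdeal k S) : constantCoeff p = 0 := by
  have : (constantCoeff.comp (toricHom k (Subtype.val : S → Fin m → ℕ)).toRingHom) =
      constantCoeff := by
    refine MvPolynomial.ringHom_ext (fun c => by simp [toricHom]) (fun x => ?_)
    have hx : (x : Fin m → ℕ) ≠ 0 := fun h => h0 (h ▸ x.2)
    obtain ⟨j, hj⟩ := Function.ne_iff.1 hx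
    have : ∏ j : Fin m, (0 : k) ^ (x : Fin m → ℕ) j = 0 :=
      Finset.prod_eq_zero (Finset.mem_univ j) (zero_pow hj)
    simpa [toricHom] using this
  rw [← this]
  have h1 : toricHom k (Subtype.val : S → Fin m → ℕ) p = 0 := hp
  change constantCoeff (toricHom k (Subtype.val : S → Fin m → ℕ) p) = 0
  rw [h1, map_zero]

/-- Setting the variables of `S` to 0 sends the ideal into `(X^B)` and `𝔪` into `(X)`, so the
product goes into `(X^(B+1))`; but this binomial goes to `X^B`. -/
theorem X_pow_sub_C_notMem (ha : a ∉ S) (h0 : 0 ∉ insert a S) (hB : mult S a ≠ 0)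
    (hn : deg Subtype.val n = mult S a • a) :
    (X ^ mult S a - C (monomial n (1 : k))) ∉
      RingHom.ker (constantCoeff.comp Polynomial.constantCoeff :
        Polynomial (MvPolynomial S k) →+* k) * stepIdeal k S a := by
  intro h
  let θ : Polynomial (MvPolynomial S k) →+* Polynomial k := Polynomial.mapRingHom constantCoeff
  have hn0 : n ≠ 0 := by
    rintro rfl
    rw [deg, map_zero, eq_comm, smul_eq_zero] at hn
    rcases hn with h | h
    · exact hB h
    · exact h0 (by simp [h])
  have hq : θ (X ^ mult S a - C (monomial n (1 : k))) = X ^ mult S a := by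
    simp [θ, constantCoeff_monomial, hn0]
  have hP : stepIdeal k S a ≤ (Ideal.span {(X ^ mult S a : Polynomial k)}).comap θ := by
    rw [stepIdeal_eq_sup ha h0 hn]
    refine sup_le ?_ ?_
    · rw [Ideal.map_le_iff_le_comap]
      intro p hp
      have : θ (C p) = 0 := by
        simp [θ, constantCoeff_eq_zero_of_mem (fun h => h0 (Finset.mem_insert_of_mem h)) hp]
      rw [Ideal.mem_comap, Ideal.mem_comap, this]
      exact zero_mem _
    · rw [Ideal.span_singleton_le_iff_mem, Ideal.mem_comap, hq]
      exact Ideal.mem_span_singleton_self _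
  have hM : RingHom.ker (constantCoeff.comp Polynomial.constantCoeff :
        Polynomial (MvPolynomial S k) →+* k) ≤ (Ideal.span {(X : Polynomial k)}).comap θ := by
    intro x hx
    rw [Ideal.mem_comap, Ideal.mem_span_singleton, Polynomial.X_dvd_iff]
    simpa [θ, RingHom.mem_ker, Polynomial.constantCoeff_apply] using hx
  have h1 := Ideal.le_comap_mul θ (Ideal.mul_mono hM hP h)
  rw [Ideal.mem_comap, hq, Ideal.span_singleton_mul_span_singleton, Ideal.mem_span_singleton,
    ← pow_succ', pow_dvd_pow_iff Polynomial.X_ne_zero Polynomial.not_isUnit_X] at h1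
  omega

/-- For `≥`, take minimal binomial generators including `q = X^B - x^n` and reduce the others modulo
`q` to `X^r g'`. As `q` is monic, `mem_of_C_mem_span_monic_sup` shows that the `g'` generate the
ideal of `S`. -/
theorem spanFinrank_stepIdeal_of_mem (ha : a ∉ S) (h0 : 0 ∉ insert a S) (hB : mult S a ≠ 0)
    (hn : deg Subtype.val n = mult S a • a) :
    (stepIdeal k S a).spanFinrank = (toricIdeal k S).spanFinrank + 1 := by
  classical
  set q : Polynomial (MvPolynomial S k) := X ^ mult S a - C (monomial n (1 : k)) with hq
  have hqP : q ∈ stepIdeal k S a := X_pow_sub_C_mem hn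
  refine le_antisymm ?_ ?_
  · obtain ⟨s, hs, hsI⟩ := 
      Submodule.FG.exists_span_finset_card_eq_spanFinrank (fg_toricIdeal (k := k) (S := S))
    rw [← hs]
    refine (spanFinrank_le_card (insert q (s.image C)) ?_).trans
      ((Finset.card_insert_le _ _).trans (Nat.succ_le_succ Finset.card_image_le))
    rw [stepIdeal_eq_sup ha h0 hn, Finset.coe_insert, Finset.coe_image, Ideal.span_insert,
      ← Ideal.map_span, sup_comm]
    congr 2
  · obtain ⟨G, hqG, hG, hspan, hcard⟩ := exists_mono_generators (k := k) ha h0 (t := {q})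
      (by rintro _ rfl; exact ⟨hqP, _, _, _, _, X_pow_sub_C_eq _⟩)
      (Or.inr ⟨q, rfl, X_pow_sub_C_notMem ha h0 hB hn⟩)
    have hqG' : q ∈ G := hqG rfl
    have hred : ∀ g : Polynomial (MvPolynomial S k), ∃ r, ∃ g' ∈ toricIdeal k S,
        g ∈ G → g - X ^ r * C g' ∈ Ideal.span {q} := by
      intro g
      by_cases hg : g ∈ G
      · obtain ⟨hg1, i, u, j, w, rfl⟩ := hG g hg
        obtain ⟨r, g', h1, h2⟩ := exists_sub_mem_span (k := k) hn
          (mono_sub_mono_mem_stepIdeal.1 hg1)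
        exact ⟨r, g', h1, fun _ => h2⟩
      · exact ⟨0, 0, zero_mem _, fun h => absurd h hg⟩
    choose r g' hg' hsub using hred
    refine le_trans (Nat.succ_le_succ (spanFinrank_le_card ((G.erase q).image g') ?_))
      (le_trans ?_ hcard)
    · refine le_antisymm (Ideal.span_le.2 ?_) ?_
      · rw [Finset.coe_image]
        rintro _ ⟨g, -, rfl⟩
        exact hg' g
      · intro h hh
        have h1 : C h ∈ stepIdeal k S a := map_C_toricIdeal_le (Ideal.mem_map_of_mem _ hh)
        refine mem_of_C_mem_span_monic_sup (q := q) (Polynomial.monic_X_pow_sub_C _ hB)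
          (by rw [hq, Polynomial.natDegree_X_pow_sub_C]; exact Nat.pos_of_ne_zero hB) ?_
        have h2 : stepIdeal k S a ≤ Ideal.span {q} ⊔
            (Ideal.span (((G.erase q).image g' : Finset (MvPolynomial S k)) : Set _)).map C := by
          rw [← hspan, Ideal.span_le]
          intro g hg
          by_cases hgq : g = q
          · rw [hgq]
            exact Ideal.mem_sup_left (Ideal.mem_span_singleton_self q)
          · refine Submodule.mem_sup.2 ⟨_, hsub g hg, X ^ r g * C (g' g), ?_, sub_add_cancel _ _⟩
            refine Ideal.mul_mem_left _ _ (Ideal.mem_map_of_mem _ (Ideal.subset_span ?_))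
            exact Finset.mem_coe.2 (Finset.mem_image_of_mem _ (Finset.mem_erase.2 ⟨hgq, hg⟩))
        exact h2 h1
    · have := Finset.card_erase_add_one hqG'
      have h3 := Finset.card_image_le (s := G.erase q) (f := g')
      omega

end Redundant

section Scale

theorem expand_mono (B i : ℕ) (u : S →₀ ℕ) :
    Polynomial.expand _ B (mono k S i u) = mono k S (B * i) u := by
  rw [Polynomial.expand_monomial, mul_comm]

theorem expand_mem_stepIdeal {B : ℕ} {p : Polynomial (MvPolynomial S k)} :
    Polynomial.expand _ B p ∈ stepIdeal k S a ↔ p ∈ stepIdeal k S (B • a) := by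
  have : (stepHom k S a).comp (Polynomial.expand (MvPolynomial S k) B : _ →+* _) =
      stepHom k S (B • a) := by
    refine Polynomial.ringHom_ext (fun c => ?_) ?_
    · change stepHom k S a (Polynomial.expand _ B (C c)) = _
      rw [Polynomial.expand_C, stepHom_C, stepHom_C]
    · change stepHom k S a (Polynomial.expand _ B X) = _
      rw [Polynomial.expand_X, map_pow, stepHom_X, stepHom_X, monomial_pow, one_pow, expo_nsmul]
  rw [stepIdeal, stepIdeal, ← this]
  rfl

theorem exists_eq_X_pow_mul_expand {i j : ℕ} {u w : S →₀ ℕ}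
    (h : i • a + deg Subtype.val u = j • a + deg Subtype.val w) :
    ∃ r, ∃ g ∈ stepIdeal k S (mult S a • a),
      mono k S i u - mono k S j w = X ^ r * Polynomial.expand _ (mult S a) g := by
  obtain ⟨r, p, p', hi, hj, h'⟩ := mult_dvd_of_relation h
  refine ⟨r, mono k S p u - mono k S p' w, mono_sub_mono_mem_stepIdeal.2 h', ?_⟩
  rw [map_sub, expand_mono, expand_mono, mono_eq, mono_eq, mono_eq, mono_eq, hi, hj]
  ring

theorem stepIdeal_eq_map_expand (ha : a ∉ S) (h0 : 0 ∉ insert a S) :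
    stepIdeal k S a = (stepIdeal k S (mult S a • a)).map
      (Polynomial.expand (MvPolynomial S k) (mult S a) : _ →+* _) := by
  refine le_antisymm (stepIdeal_le ha h0 fun i u j w h => ?_) ?_
  · obtain ⟨r, g, hg, e⟩ := exists_eq_X_pow_mul_expand (k := k) h
    rw [e]
    exact Ideal.mul_mem_left _ _ (Ideal.mem_map_of_mem _ hg)
  · rw [Ideal.map_le_iff_le_comap]
    exact fun p hp => expand_mem_stepIdeal.2 hp

/-- For `≥`, each binomial generator is `X^r` times the expansion of some `g'`. Contraction, which
inverts expansion, shows that the `g'` generate the other ideal. -/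
theorem spanFinrank_stepIdeal_nsmul (ha : a ∉ S) (h0 : 0 ∉ insert a S) (hB : mult S a ≠ 0) :
    (stepIdeal k S a).spanFinrank = (stepIdeal k S (mult S a • a)).spanFinrank := by
  classical
  refine le_antisymm ?_ ?_
  · rw [stepIdeal_eq_map_expand ha h0]
    exact Ideal.spanFinrank_map_le_of_fg _ (IsNoetherian.noetherian _)
  · obtain ⟨G, -, hG, hspan, hcard⟩ := exists_mono_generators (k := k) ha h0 (t := ∅) (by simp)
      (Or.inl rfl)
    have hred : ∀ g : Polynomial (MvPolynomial S k), ∃ r, ∃ g' ∈ stepIdeal k S (mult S a • a),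
        g ∈ G → g = X ^ r * Polynomial.expand _ (mult S a) g' := by
      intro g
      by_cases hg : g ∈ G
      · obtain ⟨hg1, i, u, j, w, rfl⟩ := hG g hg
        obtain ⟨r, g', h1, h2⟩ := exists_eq_X_pow_mul_expand (k := k)
          (mono_sub_mono_mem_stepIdeal.1 hg1)
        exact ⟨r, g', h1, fun _ => h2⟩
      · exact ⟨0, 0, zero_mem _, fun h => absurd h hg⟩
    choose r g' hg' hexp using hred
    refine (spanFinrank_le_card (G.image g') ?_).trans (Finset.card_image_le.trans hcard)
    refine le_antisymm (Ideal.span_le.2 ?_) ?_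
    · rw [Finset.coe_image]
      rintro _ ⟨g, -, rfl⟩
      exact hg' g
    · intro h hh
      have h1 : ∀ x ∈ stepIdeal k S a, Polynomial.contract (mult S a) x ∈
          Ideal.span ((G.image g' : Finset _) : Set (Polynomial (MvPolynomial S k))) := by
        intro x hx
        rw [← hspan] at hx
        -- Contraction is not multiplicative, only linear over expanded polynomials, so the
        -- induction carries an arbitrary multiplier `c`.
        refine Submodule.span_induction
          (p := fun x _ => ∀ c, Polynomial.contract (mult S a) (c * x) ∈
            Ideal.span ((G.image g' : Finset _) : Set (Polynomial (MvPolynomial S k))))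
          (fun x hx c => ?_) (fun c => ?_) (fun x y _ _ hx hy c => ?_) (fun b x _ hx c => ?_) hx 1
          |> fun h => by rwa [one_mul] at h
        · rw [hexp x hx, ← mul_assoc, Polynomial.contract_mul_expand hB]
          exact Ideal.mul_mem_left _ _ (Ideal.subset_span
            (Finset.mem_coe.2 (Finset.mem_image_of_mem _ hx)))
        · rw [mul_zero, ← map_zero C, Polynomial.contract_C, map_zero]
          exact zero_mem _
        · rw [mul_add, Polynomial.contract_add hB]
          exact add_mem (hx c) (hy c)
        · rw [smul_eq_mul, ← mul_assoc]
          exact hx _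
      have := h1 _ (expand_mem_stepIdeal.2 hh)
      rwa [Polynomial.contract_expand _ hB] at this

end Scale

/-! ### Invariance of the complete intersection property. -/

theorem isCompleteIntersection_insert_iff (ha : a ∉ S) (h0 : 0 ∉ insert a S) :
    IsCompleteIntersection (toricIdeal k (insert a S)) ↔
      IsCompleteIntersection (toricIdeal k (reduceAt S a)) := by
  by_cases hN : mult S a • a ∈ natSpan S
  · rw [reduceAt_of_mem hN, IsCompleteIntersection, IsCompleteIntersection,
      height_toricIdeal_insert ha, spanFinrank_toricIdeal_insert ha]
    by_cases hB : mult S a = 0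
    · rw [stepIdeal_eq_map_C ha h0 hB, spanFinrank_map_C fg_toricIdeal, height_map_C_of_isPrime]
    · obtain ⟨n, hn⟩ := exists_deg_eq hN
      rw [height_stepIdeal hB, spanFinrank_stepIdeal_of_mem ha h0 hB hn, Nat.cast_add, Nat.cast_one]
      exact (ENat.add_left_injective_of_ne_top ENat.one_ne_top).eq_iff
  · have hB : mult S a ≠ 0 := fun h => hN (by simp [h])
    have hB' : mult S (mult S a • a) ≠ 0 := fun h => hB (by
      have := mult_nsmul_mul (dvd_refl (mult S a))
      rwa [h, zero_mul, eq_comm] at this)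
    have hxS : mult S a • a ∉ S := fun h => hN (mem_natSpan_of_mem h)
    rw [reduceAt_of_notMem hN, IsCompleteIntersection, IsCompleteIntersection,
      height_toricIdeal_insert ha, spanFinrank_toricIdeal_insert ha,
      height_toricIdeal_insert hxS, spanFinrank_toricIdeal_insert hxS, height_stepIdeal hB,
      height_stepIdeal hB', spanFinrank_stepIdeal_nsmul ha h0 hB]

/-- A zero multiple lies in `ℕS`, so it is never inserted. -/
theorem zero_notMem_of_step {A A' : Finset (Fin m → ℕ)} (h0 : 0 ∉ A) (h : Step A A') :
    0 ∉ A' := by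
  obtain ⟨a, ha, rfl⟩ := step_iff.1 h
  have h1 : 0 ∉ A.erase a := fun h => h0 (Finset.mem_of_mem_erase h)
  by_cases hN : mult (A.erase a) a • a ∈ natSpan (A.erase a)
  · rwa [reduceAt_of_mem hN]
  · rw [reduceAt_of_notMem hN, Finset.mem_insert, not_or]
    exact ⟨fun h => hN (h ▸ zero_mem _), h1⟩

theorem isCompleteIntersection_step_iff {A A' : Finset (Fin m → ℕ)} (h0 : 0 ∉ A)
    (h : Step A A') :
    IsCompleteIntersection (toricIdeal k A) ↔ IsCompleteIntersection (toricIdeal k A') := by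
  obtain ⟨a, ha, rfl⟩ := step_iff.1 h
  have := isCompleteIntersection_insert_iff (k := k) (Finset.notMem_erase a A)
    (by rwa [Finset.insert_erase ha])
  rwa [Finset.insert_erase ha] at this

theorem isCompleteIntersection_reduction_iff {A R : Finset (Fin m → ℕ)} (h0 : 0 ∉ A)
    (h : Relation.ReflTransGen Step A R) :
    IsCompleteIntersection (toricIdeal k A) ↔ IsCompleteIntersection (toricIdeal k R) := by
  induction h using Relation.ReflTransGen.head_induction_on with
  | refl => rfl
  | head h _ ih => exact (isCompleteIntersection_step_iff h0 h).trans (ih (zero_notMem_of_step h0 h))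

theorem toricIdeal_empty : toricIdeal k (∅ : Finset (Fin m → ℕ)) = ⊥ := by
  rw [eq_bot_iff]
  intro p hp
  have : IsEmpty {x : Fin m → ℕ // x ∈ (∅ : Finset (Fin m → ℕ))} :=
    ⟨fun x => Finset.notMem_empty _ x.2⟩
  obtain ⟨c, rfl⟩ := C_surjective _ p
  have h : toricHom k _ (MvPolynomial.C c) = 0 := hp
  rw [toricHom, aeval_C, MvPolynomial.algebraMap_eq, map_eq_zero_iff _ (C_injective _ _)] at h
  rw [h, map_zero]
  exact zero_mem _

/-- Here `μ = ht = 0`, so the alternative of an empty reduction is a case of the other one. -/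
theorem isCompleteIntersection_empty :
    IsCompleteIntersection (toricIdeal k (∅ : Finset (Fin m → ℕ))) := by
  rw [toricIdeal_empty, IsCompleteIntersection, Ideal.height_bot]
  exact congrArg _ Submodule.spanFinrank_bot

end ToricReduction

theorem theorem2p4 (k : Type*) [Field k] (m : ℕ) (A : Finset (Fin m → ℕ)) (hA : 0 ∉ A) :
    (∃! R : Finset (Fin m → ℕ), ToricReduction.IsReductionOf A R) ∧
    ∀ Ared : Finset (Fin m → ℕ), ToricReduction.IsReductionOf A Ared →
      (ToricReduction.IsCompleteIntersection (ToricReduction.toricIdeal k A) ↔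
        (Ared = ∅ ∨
          ToricReduction.IsCompleteIntersection (ToricReduction.toricIdeal k Ared))) := by
  refine ⟨?_, fun R hR => ?_⟩
  · obtain ⟨R, hR⟩ := ToricReduction.exists_isReductionOf A
    exact ⟨R, hR, fun R' hR' => ToricReduction.isReductionOf_unique hR' hR⟩
  · rw [ToricReduction.isCompleteIntersection_reduction_iff hA hR.1]
    refine ⟨Or.inr, ?_⟩
    rintro (rfl | h)
    · exact ToricReduction.isCompleteIntersection_empty
    · exact h
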